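/- **Controlled equations of motion for the rolling ball.** *Data.* A ball of radius $r>0$ rolls without slipping on a plane under gravity of magnitude $g$; $\mathbf e_3=(0,0,1)^{\mathsf T}$. The ball has mass $m_0>0$, inertia tensor $\mathbb I=\mathrm{diag}(d_1,d_2,d_3)$ with $d_j>0$, and centre of mass $\boldsymbol\zeta_0\in\mathbb R^3$ relative to its geometric centre. It contains $n\ge 0$ point masses $m_i>0$ moving on rails $\boldsymbol\zeta_i:\mathbb R\to\mathbb R^3$ of class $C^3$, with parameters $\theta_i$; $M=\sum_{i=0}^n m_i$. A continuous external force $\mathbf F_{\mathrm e}(t)$ acts at the geometric centre. For $\mathbf v\in\mathbb R^3$, $\widehat{\mathbf v}$ is the matrix of $\mathbf w\mapsto\mathbf v\times\mathbf w$, $\mathbf v^\sharp$ is the quaternion $(0,\mathbf v)$, $\mathbf v_{12}=(v_1,v_2)$; $\mathfrak p^\flat$ is the vector part of the quaternion $\mathfrak p$. The state is $\boldsymbol x=(\boldsymbol\theta,\dot{\boldsymbol\theta},\mathfrak q,\boldsymbol\Omega,\boldsymbol z)\in\mathbb R^{2n+9}$, with $\mathfrak q$ a unit quaternion along trajectories,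 and the control is $\boldsymbol u=\ddot{\boldsymbol\theta}\in\mathbb R^n$. The dynamics are $$\dot{\boldsymbol x}=\mathbf f(t,\boldsymbol x,\boldsymbol u)=\Big(\dot{\boldsymbol\theta},\ \boldsymbol u,\ \tfrac12\mathfrak q\boldsymbol\Omega^\sharp,\ \boldsymbol\kappa(t,\boldsymbol x,\boldsymbol u),\ \boldsymbol w(\boldsymbol x)\Big),\qquad \boldsymbol w(\boldsymbol x)=\big([\mathfrak q\boldsymbol\Omega^\sharp\mathfrak q^{-1}]^\flat\times r\mathbf e_3\big)_{12},$$ where, with $\boldsymbol\Gamma=[\mathfrak q^{-1}\mathbf e_3^\sharp\mathfrak q]^\flat$, $\tilde{\boldsymbol\Gamma}=[\mathfrak q^{-1}\mathbf F_{\mathrm e}^\sharp\mathfrak q]^\flat$, $\mathbf s_i=r\boldsymbol\Gamma+\boldsymbol\zeta_i$ and $A=\sum_{i=0}^n m_i\widehat{\mathbf s_i}^2-\mathbb I$, $$\boldsymbol\kappa=A^{-1}\Big[\boldsymbol\Omega\times\mathbb I\boldsymbol\Omega+r\tilde{\boldsymbol\Gamma}\times\boldsymbol\Gamma+\sum_{i=0}^n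 m_i\mathbf s_i\times\big\{g\boldsymbol\Gamma+\boldsymbol\Omega\times(\boldsymbol\Omega\times\boldsymbol\zeta_i+2\dot\theta_i\boldsymbol\zeta_i')+\dot\theta_i^2\boldsymbol\zeta_i''+\ddot\theta_i\boldsymbol\zeta_i'\big\}\Big]$$ ($\boldsymbol\zeta_i,\boldsymbol\zeta_i',\boldsymbol\zeta_i''$ are evaluated at $\theta_i$, and $\boldsymbol\zeta_0$ is constant). The initial conditions are $\boldsymbol\sigma(\boldsymbol x(a))=\boldsymbol x(a)-(\boldsymbol\theta_a,\dot{\boldsymbol\theta}_a,\mathfrak q_a,\boldsymbol\Omega_a,\boldsymbol z_a)=\mathbf 0$ with $|\mathfrak q_a|=1$. The final conditions are $\boldsymbol\psi(\boldsymbol x(b))=\mathbf 0$, where $$\boldsymbol\psi(\boldsymbol x)=\Big(\boldsymbol\Pi\big(\big[\mathfrak q\,[\tfrac1M\textstyle\sum_{i=0}^n m_i\boldsymbol\zeta_i(\theta_i)]^\sharp\,\mathfrak q^{-1}\big]^\flat\big)-\boldsymbol\Delta_b,\ \dot{\boldsymbol\theta}-\dot{\boldsymbol\theta}_b,\ \boldsymbol\Omega-\boldsymbol\Omega_b,\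 \boldsymbol z-\boldsymbol z_b\Big)$$ and $\boldsymbol\Pi:\mathbb R^3\to\mathbb R^k$ is linear (for instance the projection onto some of the components). Each of the times $a$ and $b$ is either prescribed or free. The performance index is $J=p(a,b)+\int_a^b L\,dt$ with $p=\frac{\upsilon_a}2(a-a_{\mathrm e})^2+\frac{\upsilon_b}2(b-b_{\mathrm e})^2$ and $$L(t,\boldsymbol x,\boldsymbol u,\mu)=\tfrac\alpha2|\boldsymbol z-\boldsymbol z_{\mathrm d}(t)|^2+\tfrac\beta2|\boldsymbol w(\boldsymbol x)|^2+\sum_{i=1}^n\tfrac{\gamma_i}2\ddot\theta_i^2+\sum_{j=1}^K V_j(\boldsymbol z,\mu)+\delta,$$ where $\upsilon_a,\upsilon_b,\alpha,\beta,\gamma_i,\delta\ge 0$, $\boldsymbol z_{\mathrm d}$ is continuous, the $V_j$ are obstacle functions and $\mu$ is a real parameter. For a costate $\boldsymbol\lambda\in\mathbb R^{2n+9}$ and constant multipliers $\boldsymbol\xi,\boldsymbol\nu$ put $H=L+\boldsymbol\lambda^{\mathsf T}\mathbf f$, $G=p+\boldsymbol\xi^{\mathsf T}\boldsymbol\sigma(\boldsymbol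 x(a))+\boldsymbol\nu^{\mathsf T}\boldsymbol\psi(\boldsymbol x(b))$, and $$\tilde J=J+\boldsymbol\xi^{\mathsf T}\boldsymbol\sigma(\boldsymbol x(a))+\boldsymbol\nu^{\mathsf T}\boldsymbol\psi(\boldsymbol x(b))+\int_a^b\boldsymbol\lambda^{\mathsf T}(\mathbf f-\dot{\boldsymbol x})\,dt.$$ Subscripts denote partial derivatives; partial derivatives in $\mathfrak q$ are taken in $\mathbb R^4$, and derivatives are written as column vectors. The problem is *regular* if $H_{\boldsymbol u\boldsymbol u}$ is nonsingular everywhere. Let $\lambda_{n+i}$ be the component of $\boldsymbol\lambda$ belonging to $\dot\theta_i$, and $\boldsymbol\lambda_{\boldsymbol\Omega}$ its block belonging to $\boldsymbol\Omega$. *Candidates.* A candidate consists of $a<b$, trajectories $\boldsymbol x,\boldsymbol\lambda$ of class $C^1$ and $\boldsymbol u$ continuous (defined on $\mathbb R$, so that the end times can be varied), and multipliers $\boldsymbol\xi,\boldsymbol\nu$, such that for all $t\in[a,b]$ one has $|\mathfrak q(t)|=1$ and every $V_j(\cdot,\mu)$ is $C^1$ near $\boldsymbol z(t)$. It is an *extremal*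 if $d\tilde J=0$, that is, $\frac{d}{d\epsilon}\tilde J\big|_{\epsilon=0}$ exists and is $0$ along every family $(a+\epsilon\,da,\ b+\epsilon\,db,\ \boldsymbol x+\epsilon\,\delta\boldsymbol x,\ \boldsymbol\lambda+\epsilon\,\delta\boldsymbol\lambda,\ \boldsymbol u+\epsilon\,\delta\boldsymbol u,\ \boldsymbol\xi+\epsilon\,d\boldsymbol\xi,\ \boldsymbol\nu+\epsilon\,d\boldsymbol\nu)$ with $\delta\boldsymbol x,\delta\boldsymbol\lambda$ of class $C^1$, $\delta\boldsymbol u$ continuous, $da=0$ if $a$ is prescribed and $db=0$ if $b$ is prescribed. **Claim.** 1. $A$ is always invertible. $H$ is smooth in $\boldsymbol u$, and everywhere $$H_{u_i}=\gamma_i\ddot\theta_i+\lambda_{n+i}+\boldsymbol\lambda_{\boldsymbol\Omega}^{\mathsf T}A^{-1}\big(m_i\mathbf s_i\times\boldsymbol\zeta_i'\big),\qquad H_{\boldsymbol u\boldsymbol u}=\mathrm{diag}(\gamma_1,\dots,\gamma_n).$$ Hence $H_{\boldsymbol u\boldsymbol u}>0$ iff all $\gamma_i>0$, and the problem is regular iff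 all $\gamma_i>0$. 2. If the problem is regular, then for each $i$ $$H_{u_i}=0\iff\ddot\theta_i=\pi_i(\boldsymbol x,\boldsymbol\lambda):=-\gamma_i^{-1}\Big\{\lambda_{n+i}+\boldsymbol\lambda_{\boldsymbol\Omega}^{\mathsf T}A^{-1}\big(m_i\mathbf s_i\times\boldsymbol\zeta_i'\big)\Big\},$$ so that $H_{\boldsymbol u}=\mathbf 0$ iff $\boldsymbol u=\boldsymbol\pi(\boldsymbol x,\boldsymbol\lambda)$. 3. $H_{\boldsymbol\lambda}=\mathbf f$, $G_{\boldsymbol\xi}=\boldsymbol\sigma$ and $G_{\boldsymbol\nu}=\boldsymbol\psi$. If the problem is regular, let $\hat H(t,\boldsymbol x,\boldsymbol\lambda,\mu)=H(t,\boldsymbol x,\boldsymbol\lambda,\boldsymbol\pi(\boldsymbol x,\boldsymbol\lambda),\mu)$ and $\hat{\mathbf f}(t,\boldsymbol x,\boldsymbol\lambda)=\mathbf f(t,\boldsymbol x,\boldsymbol\pi(\boldsymbol x,\boldsymbol\lambda))$. Then $\hat H_{\boldsymbol\lambda}=\hat{\mathbf f}$, and at every $\boldsymbol x$ with $|\mathfrak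 q|=1$ such that all $V_j(\cdot,\mu)$ are differentiable at $\boldsymbol z$, one has $\hat H_{\boldsymbol x}=H_{\boldsymbol x}|_{\boldsymbol u=\boldsymbol\pi}$ (all these derivatives exist). 4. A candidate is an extremal iff on $[a,b]$ $$\dot{\boldsymbol x}=H_{\boldsymbol\lambda},\qquad\dot{\boldsymbol\lambda}=-H_{\boldsymbol x},\qquad H_{\boldsymbol u}=\mathbf 0,$$ together with $H|_{t=a}=G_a$ (dropped if $a$ is prescribed), $\boldsymbol\lambda(a)=-G_{\boldsymbol x(a)}$, $\boldsymbol\sigma(\boldsymbol x(a))=\mathbf 0$, $H|_{t=b}=-G_b$ (dropped if $b$ is prescribed), $\boldsymbol\lambda(b)=G_{\boldsymbol x(b)}$, $\boldsymbol\psi(\boldsymbol x(b))=\mathbf 0$. 5. If the problem is regular, a candidate is an extremal iff $\boldsymbol u(t)=\boldsymbol\pi(\boldsymbol x(t),\boldsymbol\lambda(t))$ on $[a,b]$ and $(\boldsymbol x,\boldsymbol\lambda)$ solves the ODE two-point boundary value problem $$\dot{\boldsymbol x}=\hat H_{\boldsymbol\lambda}=\hat{\mathbf f},\qquad\dot{\boldsymbol\lambda}=-\hat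 H_{\boldsymbol x}\qquad\text{on }[a,b],$$ $$\hat H|_{t=a}=G_a,\quad\boldsymbol\lambda(a)=-G_{\boldsymbol x(a)},\quad\boldsymbol\sigma(\boldsymbol x(a))=\mathbf 0,\qquad \hat H|_{t=b}=-G_b,\quad\boldsymbol\lambda(b)=G_{\boldsymbol x(b)},\quad\boldsymbol\psi(\boldsymbol x(b))=\mathbf 0,$$ where $\hat H|_{t=a}=G_a$ is dropped if $a$ is prescribed and $\hat H|_{t=b}=-G_b$ is dropped if $b$ is prescribed. -/

import Mathlib

open scoped Matrix Quaternion ContDiff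

noncomputable section

namespace RollingBall

/-! ### Partial derivatives -/

/-- The column vector `F_yᵀ` of the partial derivatives of a scalar function `F` at `y`. -/
def grad {ι : Type*} [Fintype ι] [DecidableEq ι] (F : (ι → ℝ) → ℝ) (y : ι → ℝ) : ι → ℝ :=
  fun i => fderiv ℝ F y (Pi.single i 1)

/-- The matrix `F_yy` of the second partial derivatives `F_{y_i y_j}` of `F` at `y`. -/
def hess {ι : Type*} [Fintype ι] [DecidableEq ι] (F : (ι → ℝ) → ℝ) (y : ι → ℝ) : Matrix ι ι ℝ :=
  Matrix.of fun i j => grad (fun w => grad F w i) y j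

/-! ### Vectors of `ℝ³` and quaternions -/

/-- The skew-symmetric matrix `v̂` of the map `w ↦ v × w`. -/
def hat (v : Fin 3 → ℝ) : Matrix (Fin 3) (Fin 3) ℝ :=
  !![0, -v 2, v 1; v 2, 0, -v 0; -v 1, v 0, 0]

/-- `v♯`: a vector of `ℝ³` as a purely imaginary quaternion. -/
def sharp (v : Fin 3 → ℝ) : ℍ[ℝ] := ⟨0, v 0, v 1, v 2⟩

/-- `p♭`: the vector part of a quaternion. -/
def flat (p : ℍ[ℝ]) : Fin 3 → ℝ := ![p.imI, p.imJ, p.imK]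

/-- The third standard basis vector of `ℝ³`. -/
def e3 : Fin 3 → ℝ := ![0, 0, 1]

/-- `v₁₂`: the first two components of a vector of `ℝ³`. -/
def first2 (v : Fin 3 → ℝ) : Fin 2 → ℝ := ![v 0, v 1]

/-! ### States, controls, candidates -/

/-- Labels of the `2n + 9` coordinates of the state, in the order `θ, θ̇, 𝔮, Ω, z`. -/
abbrev StateIdx (n : ℕ) := Fin n ⊕ Fin n ⊕ Fin 4 ⊕ Fin 3 ⊕ Fin 2

/-- State vectors `x = (θ, θ̇, 𝔮, Ω, z)`; costates have the same blocks. -/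
abbrev State (n : ℕ) := StateIdx n → ℝ

/-- Controls `u = θ̈`. -/
abbrev Control (n : ℕ) := Fin n → ℝ

/-- Labels of the final conditions: projected centre of mass, `θ̇`, `Ω`, `z`. -/
abbrev FinalIdx (n k : ℕ) := Fin k ⊕ Fin n ⊕ Fin 3 ⊕ Fin 2

/-- The state vector with the given five blocks. -/
def mkState {n : ℕ} (th dth : Fin n → ℝ) (q : ℍ[ℝ]) (Om : Fin 3 → ℝ) (z : Fin 2 → ℝ) : State n :=
  Sum.elim th (Sum.elim dth (Sum.elim ![q.re, q.imI, q.imJ, q.imK] (Sum.elim Om z)))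

/-- The block `θ` of a state. -/
def theta {n : ℕ} (x : State n) : Fin n → ℝ := fun i => x (.inl i)

/-- The block `θ̇` of a state; of a costate it is `(λ_{n+1}, …, λ_{2n})`. -/
def dtheta {n : ℕ} (x : State n) : Fin n → ℝ := fun i => x (.inr (.inl i))

/-- The block `𝔮` of a state. -/
def quat {n : ℕ} (x : State n) : ℍ[ℝ] :=
  ⟨x (.inr (.inr (.inl 0))), x (.inr (.inr (.inl 1))), x (.inr (.inr (.inl 2))),
    x (.inr (.inr (.inl 3)))⟩

/-- The block `Ω` of a state; of a costate it is `λ_Ω = (λ_{2n+5}, λ_{2n+6}, λ_{2n+7})`. -/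
def Omega {n : ℕ} (x : State n) : Fin 3 → ℝ := fun i => x (.inr (.inr (.inr (.inl i))))

/-- The block `z` of a state. -/
def zpos {n : ℕ} (x : State n) : Fin 2 → ℝ := fun i => x (.inr (.inr (.inr (.inr i))))

/-- Initial and final time, state, costate and control trajectories, and the multipliers of the
initial and final conditions. Only the restrictions of the trajectories to `[a, b]` matter at the
candidate itself; they are defined on `ℝ` so that the end times can be varied. -/
structure Candidate (n k : ℕ) where
  /-- initial time -/
  a : ℝ
  /-- final time -/
  b : ℝ
  /-- state trajectory -/
  x : ℝ → State n
  /-- costate trajectory -/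
  lam : ℝ → State n
  /-- control trajectory -/
  u : ℝ → Control n
  /-- multiplier of the initial conditions -/
  xi : State n
  /-- multiplier of the final conditions -/
  nu : FinalIdx n k → ℝ

/-- A direction in which a candidate is varied. -/
structure Variation (n k : ℕ) where
  /-- change of the initial time -/
  da : ℝ
  /-- change of the final time -/
  db : ℝ
  /-- variation of the state -/
  dx : ℝ → State n
  /-- variation of the costate -/
  dlam : ℝ → State n
  /-- variation of the control -/
  du : ℝ → Control n
  /-- change of the initial multiplier -/
  dxi : State n
  /-- change of the final multiplier -/
  dnu : FinalIdx n k → ℝ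
  dx_smooth : ContDiff ℝ 1 dx
  dlam_smooth : ContDiff ℝ 1 dlam
  du_cont : Continuous du

/-- The one-parameter family of candidates through `c` in the direction `v`. -/
def Candidate.perturb {n k : ℕ} (c : Candidate n k) (v : Variation n k) (ε : ℝ) :
    Candidate n k where
  a := c.a + ε * v.da
  b := c.b + ε * v.db
  x := fun t => c.x t + ε • v.dx t
  lam := fun t => c.lam t + ε • v.dlam t
  u := fun t => c.u t + ε • v.du t
  xi := c.xi + ε • v.dxi
  nu := c.nu + ε • v.dnu

/-! ### The rolling ball and its optimal control problem -/

/-- The data of the optimal control problem for a ball with `n` control masses on rails, `K`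
obstacles, and `k` prescribed components of the final centre of mass. -/
structure Problem (n K k : ℕ) where
  /-- radius of the ball -/
  r : ℝ
  r_pos : 0 < r
  /-- magnitude of gravity -/
  g : ℝ
  /-- masses: index `0` is the ball with its static structure, index `i` the `i`-th point mass -/
  m : Fin (n + 1) → ℝ
  m_pos : ∀ i, 0 < m i
  /-- principal moments of inertia of the ball with its static structure -/
  d : Fin 3 → ℝ
  d_pos : ∀ i, 0 < d i
  /-- centre of mass of the ball with its static structure, relative to the geometric centre -/
  zeta0 : Fin 3 → ℝ
  /-- the rails, in the body frame translated to the geometric centre -/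
  rail : Fin n → ℝ → Fin 3 → ℝ
  rail_smooth : ∀ i, ContDiff ℝ 3 (rail i)
  /-- external force at the geometric centre, in the spatial frame -/
  Fe : ℝ → Fin 3 → ℝ
  Fe_cont : Continuous Fe
  /-- desired path of the geometric centre -/
  zd : ℝ → Fin 2 → ℝ
  zd_cont : Continuous zd
  /-- obstacle functions `V_j(z, μ)` -/
  V : Fin K → (Fin 2 → ℝ) → ℝ → ℝ
  /-- reference initial time -/
  ae : ℝ
  /-- reference final time -/
  be : ℝ
  /-- weight `υ_a` -/
  upsA : ℝ
  upsA_nonneg : 0 ≤ upsA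
  /-- weight `υ_b` -/
  upsB : ℝ
  upsB_nonneg : 0 ≤ upsB
  /-- tracking weight -/
  α : ℝ
  α_nonneg : 0 ≤ α
  /-- energy weight -/
  β : ℝ
  β_nonneg : 0 ≤ β
  /-- control weights -/
  γ : Fin n → ℝ
  γ_nonneg : ∀ i, 0 ≤ γ i
  /-- time weight -/
  δ : ℝ
  δ_nonneg : 0 ≤ δ
  /-- prescribed `θ(a)` -/
  thetaA : Fin n → ℝ
  /-- prescribed `θ̇(a)` -/
  dthetaA : Fin n → ℝ
  /-- prescribed versor `𝔮(a)` -/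
  qA : ℍ[ℝ]
  qA_unit : ‖qA‖ = 1
  /-- prescribed `Ω(a)` -/
  OmegaA : Fin 3 → ℝ
  /-- prescribed `z(a)` -/
  zA : Fin 2 → ℝ
  /-- the projection `Π` selecting the prescribed components of the final centre of mass -/
  proj : (Fin 3 → ℝ) →ₗ[ℝ] (Fin k → ℝ)
  /-- prescribed projected centre of mass at time `b` -/
  DeltaB : Fin k → ℝ
  /-- prescribed `θ̇(b)` -/
  dthetaB : Fin n → ℝ
  /-- prescribed `Ω(b)` -/
  OmegaB : Fin 3 → ℝ
  /-- prescribed `z(b)` -/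
  zB : Fin 2 → ℝ

namespace Problem

variable {n K k : ℕ} (P : Problem n K k)

/-- `ζ_i` for `0 ≤ i ≤ n`, where `ζ_0` is constant. -/
def zeta : Fin (n + 1) → ℝ → Fin 3 → ℝ := Fin.cons (fun _ => P.zeta0) P.rail

/-- Extension of `(w_1, …, w_n)` by `w_0 = 0`; the value of `w_0` is irrelevant where it is used,
since `ζ_0` is constant. -/
def ext0 (w : Fin n → ℝ) : Fin (n + 1) → ℝ := Fin.cons 0 w

/-- `ζ_i(θ_i)`. -/
def zetaAt (x : State n) (i : Fin (n + 1)) : Fin 3 → ℝ := P.zeta i (ext0 (theta x) i)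

/-- `ζ_i'(θ_i)`. -/
def dzetaAt (x : State n) (i : Fin (n + 1)) : Fin 3 → ℝ := deriv (P.zeta i) (ext0 (theta x) i)

/-- `ζ_i''(θ_i)`. -/
def ddzetaAt (x : State n) (i : Fin (n + 1)) : Fin 3 → ℝ :=
  deriv (deriv (P.zeta i)) (ext0 (theta x) i)

/-- `Γ = [𝔮⁻¹ e₃♯ 𝔮]♭`. -/
def Gam (x : State n) : Fin 3 → ℝ := flat ((quat x)⁻¹ * sharp e3 * quat x)

/-- `Γ̃ = [𝔮⁻¹ F_e♯ 𝔮]♭`. -/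
def tGam (t : ℝ) (x : State n) : Fin 3 → ℝ := flat ((quat x)⁻¹ * sharp (P.Fe t) * quat x)

/-- `s_i = r Γ + ζ_i`. -/
def s (x : State n) (i : Fin (n + 1)) : Fin 3 → ℝ := P.r • Gam x + P.zetaAt x i

/-- `𝕀 = diag(d₁, d₂, d₃)`. -/
def inertia : Matrix (Fin 3) (Fin 3) ℝ := Matrix.diagonal P.d

/-- `∑_{i=0}^n m_i ŝ_i² - 𝕀`. -/
def massMatrix (x : State n) : Matrix (Fin 3) (Fin 3) ℝ :=
  (∑ i, P.m i • (hat (P.s x i) * hat (P.s x i))) - P.inertia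

/-- `κ(t, x, u)`, the body angular acceleration. -/
def kappa (t : ℝ) (x : State n) (u : Control n) : Fin 3 → ℝ :=
  (P.massMatrix x)⁻¹ *ᵥ
    (Omega x ⨯₃ (P.inertia *ᵥ Omega x) + P.r • (P.tGam t x ⨯₃ Gam x)
      + ∑ i, P.m i • (P.s x i ⨯₃
          (P.g • Gam x
            + Omega x ⨯₃ (Omega x ⨯₃ P.zetaAt x i + (2 * ext0 (dtheta x) i) • P.dzetaAt x i)
            + (ext0 (dtheta x) i) ^ 2 • P.ddzetaAt x i
            + ext0 u i • P.dzetaAt x i)))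

/-- `([𝔮 Ω♯ 𝔮⁻¹]♭ × r e₃)₁₂`, the velocity of the geometric centre. -/
def zdot (x : State n) : Fin 2 → ℝ :=
  first2 (flat (quat x * sharp (Omega x) * (quat x)⁻¹) ⨯₃ (P.r • e3))

/-- The right-hand side `f(t, x, u)` of the system dynamics. -/
def f (t : ℝ) (x : State n) (u : Control n) : State n :=
  mkState (dtheta x) u ((1 / 2 : ℝ) • (quat x * sharp (Omega x))) (P.kappa t x u) (P.zdot x)

/-- The initial conditions `σ`. -/
def sigma (xa : State n) : State n :=
  xa - mkState P.thetaA P.dthetaA P.qA P.OmegaA P.zA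

/-- The centre of mass of the whole system relative to the geometric centre, in the spatial
frame. -/
def comSpatial (x : State n) : Fin 3 → ℝ :=
  flat (quat x * sharp ((∑ i, P.m i)⁻¹ • ∑ i, P.m i • P.zetaAt x i) * (quat x)⁻¹)

/-- The final conditions `ψ`. -/
def psi (xb : State n) : FinalIdx n k → ℝ :=
  Sum.elim (P.proj (P.comSpatial xb) - P.DeltaB)
    (Sum.elim (dtheta xb - P.dthetaB) (Sum.elim (Omega xb - P.OmegaB) (zpos xb - P.zB)))

/-- The endpoint cost `p`. -/
def endCost (a b : ℝ) : ℝ := P.upsA / 2 * (a - P.ae) ^ 2 + P.upsB / 2 * (b - P.be) ^ 2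

/-- The integrand cost `L`. -/
def L (μ t : ℝ) (x : State n) (u : Control n) : ℝ :=
  P.α / 2 * ((zpos x - P.zd t) ⬝ᵥ (zpos x - P.zd t)) + P.β / 2 * (P.zdot x ⬝ᵥ P.zdot x)
    + ∑ i, P.γ i / 2 * u i ^ 2 + ∑ j, P.V j (zpos x) μ + P.δ

/-- The performance index `J`. -/
def J (μ : ℝ) (c : Candidate n k) : ℝ :=
  P.endCost c.a c.b + ∫ t in c.a..c.b, P.L μ t (c.x t) (c.u t)

/-- The performance index `J̃` augmented by the initial, final and dynamic constraints. -/
def Jaug (μ : ℝ) (c : Candidate n k) : ℝ :=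
  P.J μ c + c.xi ⬝ᵥ P.sigma (c.x c.a) + c.nu ⬝ᵥ P.psi (c.x c.b)
    + ∫ t in c.a..c.b, c.lam t ⬝ᵥ (P.f t (c.x t) (c.u t) - deriv c.x t)

/-- The endpoint function `G`. -/
def G (a : ℝ) (xa xi : State n) (b : ℝ) (xb : State n) (nu : FinalIdx n k → ℝ) : ℝ :=
  P.endCost a b + xi ⬝ᵥ P.sigma xa + nu ⬝ᵥ P.psi xb

/-- The Hamiltonian `H`. -/
def H (μ t : ℝ) (x lam : State n) (u : Control n) : ℝ :=
  P.L μ t x u + lam ⬝ᵥ P.f t x u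

/-- `H_u`. -/
def Hu (μ t : ℝ) (x lam : State n) (u : Control n) : Fin n → ℝ :=
  grad (fun w => P.H μ t x lam w) u

/-- `H_uu`. -/
def Huu (μ t : ℝ) (x lam : State n) (u : Control n) : Matrix (Fin n) (Fin n) ℝ :=
  hess (fun w => P.H μ t x lam w) u

/-- The optimal control problem is regular: `H_uu` is nonsingular. -/
def IsRegular : Prop :=
  ∀ (μ t : ℝ) (x lam : State n) (u : Control n), IsUnit (P.Huu μ t x lam u)

/-- The control law `π`. -/
def ctrl (x lam : State n) : Control n := fun i =>
  -(P.γ i)⁻¹ * (dtheta lam i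
    + Omega lam ⬝ᵥ ((P.massMatrix x)⁻¹ *ᵥ (P.m i.succ • (P.s x i.succ ⨯₃ P.dzetaAt x i.succ))))

/-- The regular Hamiltonian `Ĥ`. -/
def Hhat (μ t : ℝ) (x lam : State n) : ℝ := P.H μ t x lam (P.ctrl x lam)

/-- `f̂`. -/
def fhat (t : ℝ) (x lam : State n) : State n := P.f t x (P.ctrl x lam)

/-- Standing assumptions on a candidate: `a < b`, classical regularity of the trajectories, the
orientation is a versor, and the obstacle functions are `C¹` along the path of the ball. -/
structure IsAdmissible (μ : ℝ) (c : Candidate n k) : Prop where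
  lt : c.a < c.b
  x_smooth : ContDiff ℝ 1 c.x
  lam_smooth : ContDiff ℝ 1 c.lam
  u_cont : Continuous c.u
  versor : ∀ t ∈ Set.Icc c.a c.b, ‖quat (c.x t)‖ = 1
  obstacle : ∀ t ∈ Set.Icc c.a c.b, ∀ j, ContDiffAt ℝ 1 (fun z => P.V j z μ) (zpos (c.x t))

/-- `dJ̃ = 0`: the augmented performance index is stationary at `c` under all variations of
state, costate, control, multipliers, and of those end times that are free. -/
def IsStationary (μ : ℝ) (aFree bFree : Prop) (c : Candidate n k) : Prop :=
  ∀ v : Variation n k, (¬ aFree → v.da = 0) → (¬ bFree → v.db = 0) →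
    HasDerivAt (fun ε : ℝ => P.Jaug μ (c.perturb v ε)) 0 0

/-- The differential-algebraic two-point boundary value problem given by the Hamiltonian. -/
structure SolvesDAE (μ : ℝ) (aFree bFree : Prop) (c : Candidate n k) : Prop where
  state : ∀ t ∈ Set.Icc c.a c.b,
    HasDerivWithinAt c.x (grad (fun l => P.H μ t (c.x t) l (c.u t)) (c.lam t))
      (Set.Icc c.a c.b) t
  costate : ∀ t ∈ Set.Icc c.a c.b,
    HasDerivWithinAt c.lam (-grad (fun y => P.H μ t y (c.lam t) (c.u t)) (c.x t))
      (Set.Icc c.a c.b) t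
  control : ∀ t ∈ Set.Icc c.a c.b, P.Hu μ t (c.x t) (c.lam t) (c.u t) = 0
  time_a : aFree → P.H μ c.a (c.x c.a) (c.lam c.a) (c.u c.a)
    = deriv (fun a => P.G a (c.x c.a) c.xi c.b (c.x c.b) c.nu) c.a
  costate_a : c.lam c.a = -grad (fun y => P.G c.a y c.xi c.b (c.x c.b) c.nu) (c.x c.a)
  init : P.sigma (c.x c.a) = 0
  time_b : bFree → P.H μ c.b (c.x c.b) (c.lam c.b) (c.u c.b)
    = -deriv (fun b => P.G c.a (c.x c.a) c.xi b (c.x c.b) c.nu) c.b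
  costate_b : c.lam c.b = grad (fun y => P.G c.a (c.x c.a) c.xi c.b y c.nu) (c.x c.b)
  final : P.psi (c.x c.b) = 0

/-- The ordinary differential equation two-point boundary value problem given by the regular
Hamiltonian: the controlled equations of motion. The control trajectory does not occur in it. -/
structure SolvesODE (μ : ℝ) (aFree bFree : Prop) (c : Candidate n k) : Prop where
  state : ∀ t ∈ Set.Icc c.a c.b,
    HasDerivWithinAt c.x (grad (fun l => P.Hhat μ t (c.x t) l) (c.lam t)) (Set.Icc c.a c.b) t
  costate : ∀ t ∈ Set.Icc c.a c.b,
    HasDerivWithinAt c.lam (-grad (fun y => P.Hhat μ t y (c.lam t)) (c.x t))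
      (Set.Icc c.a c.b) t
  time_a : aFree → P.Hhat μ c.a (c.x c.a) (c.lam c.a)
    = deriv (fun a => P.G a (c.x c.a) c.xi c.b (c.x c.b) c.nu) c.a
  costate_a : c.lam c.a = -grad (fun y => P.G c.a y c.xi c.b (c.x c.b) c.nu) (c.x c.a)
  init : P.sigma (c.x c.a) = 0
  time_b : bFree → P.Hhat μ c.b (c.x c.b) (c.lam c.b)
    = -deriv (fun b => P.G c.a (c.x c.a) c.xi b (c.x c.b) c.nu) c.b
  costate_b : c.lam c.b = grad (fun y => P.G c.a (c.x c.a) c.xi c.b y c.nu) (c.x c.b)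
  final : P.psi (c.x c.b) = 0

end Problem

end RollingBall

end

noncomputable section

namespace RollingBall

open Filter Topology Set MeasureTheory

section

/-! ### Calculus of variations on an interval -/

theorem fderiv_apply_eq_grad_dotProduct {ι : Type*} [Fintype ι] [DecidableEq ι]
    (F : (ι → ℝ) → ℝ) (y v : ι → ℝ) : fderiv ℝ F y v = grad F y ⬝ᵥ v := by
  conv_lhs => rw [← Finset.univ_sum_single v]
  rw [map_sum, dotProduct]
  refine Finset.sum_congr rfl fun i _ => ?_
  have : (Pi.single i (v i) : ι → ℝ) = v i • Pi.single i 1 := by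
    rw [← Pi.single_smul, smul_eq_mul, mul_one]
  rw [this, map_smul, smul_eq_mul, mul_comm, grad]

theorem grad_eq_of_hasFDerivAt {ι : Type*} [Fintype ι] [DecidableEq ι]
    {F : (ι → ℝ) → ℝ} {y w : ι → ℝ} {F' : (ι → ℝ) →L[ℝ] ℝ} (hF : HasFDerivAt F F' y)
    (hw : ∀ v, F' v = w ⬝ᵥ v) : grad F y = w := by
  funext i
  rw [grad, hF.fderiv, hw, dotProduct_single_one]

/-- Differentiability of `ε ↦ ∫ t in b..b+εd, g ε t` at `0`. -/
theorem hasDerivAt_integral_shrinking {g : ℝ → ℝ → ℝ} {b d : ℝ}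
    (hg : ContinuousAt (fun z : ℝ × ℝ => g z.1 z.2) (0, b))
    (hint : ∀ᶠ ε in 𝓝 (0 : ℝ), IntervalIntegrable (g ε) volume b (b + ε * d)) :
    HasDerivAt (fun ε => ∫ t in b..(b + ε * d), g ε t) (g 0 b * d) 0 := by
  rw [hasDerivAt_iff_isLittleO_nhds_zero, Asymptotics.isLittleO_iff]
  intro C hC
  obtain ⟨η, hη, hη'⟩ := Metric.continuousAt_iff.1 hg (C / (|d| + 1)) (by positivity)
  have h1 : ∀ᶠ ε in 𝓝 (0 : ℝ), |ε| < η :=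
    (continuous_abs.tendsto' (0 : ℝ) 0 abs_zero).eventually_lt_const hη
  have h2 : ∀ᶠ ε in 𝓝 (0 : ℝ), |ε * d| < η :=
    ((by fun_prop : Continuous fun ε : ℝ => |ε * d|).tendsto' 0 0 (by simp)).eventually_lt_const hη
  filter_upwards [h1, h2, hint] with ε h1 h2 h3
  have key : (∫ t in b..(b + ε * d), g ε t) - ε * (g 0 b * d)
      = ∫ t in b..(b + ε * d), (g ε t - g 0 b) := by
    rw [intervalIntegral.integral_sub h3 intervalIntegrable_const,
      intervalIntegral.integral_const, smul_eq_mul]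
    ring
  simp only [zero_add, zero_mul, add_zero, intervalIntegral.integral_same, sub_zero, smul_eq_mul]
  rw [key]
  have hb : ‖∫ t in b..(b + ε * d), (g ε t - g 0 b)‖ ≤ C / (|d| + 1) * |b + ε * d - b| := by
    apply intervalIntegral.norm_integral_le_of_norm_le_const
    intro t ht
    have ht' : |t - b| ≤ |ε * d| := by
      have := Set.abs_sub_left_of_mem_uIcc (Set.uIoc_subset_uIcc ht)
      simpa using this
    have := @hη' (ε, t) (by
      rw [Prod.dist_eq, max_lt_iff]
      constructor
      · simpa using h1
      · simpa [Real.dist_eq] using ht'.trans_lt h2)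
    rw [Real.dist_eq] at this
    exact this.le
  refine hb.trans ?_
  rw [add_sub_cancel_left, abs_mul, Real.norm_eq_abs]
  have : C / (|d| + 1) * |d| ≤ C := by
    rw [div_mul_eq_mul_div, div_le_iff₀ (by positivity)]
    nlinarith [abs_nonneg d]
  nlinarith [abs_nonneg ε]

variable {E : Type*} [NormedAddCommGroup E] [NormedSpace ℝ E]

theorem isOpen_setOf_contDiffAt_one (Φ : E → ℝ) : IsOpen {e | ContDiffAt ℝ 1 Φ e} :=
  isOpen_iff_mem_nhds.2 fun _ he => ContDiffAt.eventually he (by simp)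

theorem continuousOn_fderiv_apply_comp {Φ : E → ℝ} {T : Type*} [TopologicalSpace T] {p v : T → E}
    {s : Set T} (hp : Continuous p) (hv : Continuous v) (hΦ : ∀ t ∈ s, ContDiffAt ℝ 1 Φ (p t)) :
    ContinuousOn (fun t => fderiv ℝ Φ (p t) (v t)) s := by
  intro t ht
  have h1 : ContinuousAt (fun t => fderiv ℝ Φ (p t)) t :=
    ContinuousAt.comp (f := p) (g := fderiv ℝ Φ)
      (((hΦ t ht).fderiv_right (m := 0) (by simp)).continuousAt) hp.continuousAt
  exact (h1.clm_apply hv.continuousAt).continuousWithinAt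

/-- Leibniz' rule for an integral with moving end points. -/
theorem hasDerivAt_integral_line {Φ : E → ℝ} {p v : ℝ → E} (hp : Continuous p) (hv : Continuous v)
    {a b : ℝ} (hab : a < b) (hΦ : ∀ t ∈ Icc a b, ContDiffAt ℝ 1 Φ (p t)) (da db : ℝ) :
    HasDerivAt (fun ε : ℝ => ∫ t in (a + ε * da)..(b + ε * db), Φ (p t + ε • v t))
      ((∫ t in a..b, fderiv ℝ Φ (p t) (v t)) + Φ (p b) * db - Φ (p a) * da) 0 := by
  have hline : Continuous fun z : ℝ × ℝ => p z.2 + z.1 • v z.2 := by fun_prop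
  have hS : IsOpen ((fun z : ℝ × ℝ => p z.2 + z.1 • v z.2) ⁻¹' {e | ContDiffAt ℝ 1 Φ e}) :=
    (isOpen_setOf_contDiffAt_one Φ).preimage hline
  obtain ⟨η, hη, hηS⟩ := ((isCompact_singleton (x := (0 : ℝ))).prod
    (isCompact_Icc (a := a) (b := b))).exists_cthickening_subset_open hS (by
      rintro ⟨ε, t⟩ ⟨rfl, ht⟩
      simpa using hΦ t ht)
  have hbox : ∀ ε t : ℝ, |ε| ≤ η → t ∈ Icc (a - η) (b + η) →
      ContDiffAt ℝ 1 Φ (p t + ε • v t) := by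
    intro ε t hε ht
    refine hηS (a := (ε, t)) ?_
    let t' := max a (min b t)
    refine Metric.mem_cthickening_of_dist_le (ε, t) (0, t') η _
      ⟨rfl, le_max_left _ _, max_le hab.le (min_le_left _ _)⟩ ?_
    rw [Prod.dist_eq, max_le_iff]
    refine ⟨by simpa using hε, ?_⟩
    rw [Real.dist_eq, abs_le]
    simp only [t']
    obtain ⟨h1, h2⟩ := ht
    rcases le_total b t with h | h
    · rw [min_eq_left h, max_eq_right hab.le]; constructor <;> linarith
    · rw [min_eq_right h]
      rcases le_total a t with h' | h'
      · rw [max_eq_right h']; constructor <;> linarith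
      · rw [max_eq_left h']; constructor <;> linarith
  have hcont : ∀ ε : ℝ, |ε| ≤ η →
      ContinuousOn (fun t => Φ (p t + ε • v t)) (Icc (a - η) (b + η)) := by
    intro ε hε t ht
    exact (ContinuousAt.comp (f := fun t => p t + ε • v t) (g := Φ) (hbox ε t hε ht).continuousAt
      (by fun_prop)).continuousWithinAt
  have hint : ∀ ε : ℝ, |ε| ≤ η → ∀ α β, α ∈ Icc (a - η) (b + η) → β ∈ Icc (a - η) (b + η) →
      IntervalIntegrable (fun t => Φ (p t + ε • v t)) volume α β := by
    intro ε hε α β hα hβ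
    exact ((hcont ε hε).mono (uIcc_subset_Icc hα hβ)).intervalIntegrable
  have ha : a ∈ Icc (a - η) (b + η) := ⟨by linarith, by linarith⟩
  have hb : b ∈ Icc (a - η) (b + η) := ⟨by linarith, by linarith⟩
  have hsub : Icc a b ⊆ Icc (a - η) (b + η) := Icc_subset_Icc (by linarith) (by linarith)
  have hnear : ∀ᶠ ε in 𝓝 (0 : ℝ), |ε| ≤ η :=
    ((continuous_abs.tendsto' (0 : ℝ) 0 abs_zero).eventually_lt_const hη).mono fun _ h => h.le
  have hmove : ∀ e d : ℝ, e ∈ Icc a b →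
      ∀ᶠ ε in 𝓝 (0 : ℝ), e + ε * d ∈ Icc (a - η) (b + η) := by
    intro e d he
    refine ((by fun_prop : Continuous fun ε : ℝ => e + ε * d).tendsto' 0 e (by simp)) ?_
    exact Icc_mem_nhds (by linarith [he.1]) (by linarith [he.2])
  have ha' : a ∈ Icc a b := ⟨le_rfl, hab.le⟩
  have hb' : b ∈ Icc a b := ⟨hab.le, le_rfl⟩
  have hend : ∀ e d : ℝ, e ∈ Icc a b →
      HasDerivAt (fun ε => ∫ t in e..(e + ε * d), Φ (p t + ε • v t)) (Φ (p e) * d) 0 := by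
    intro e d he
    have := hasDerivAt_integral_shrinking (g := fun ε t => Φ (p t + ε • v t)) (b := e) (d := d) ?_ ?_
    · simpa using this
    · exact ContinuousAt.comp (f := fun z : ℝ × ℝ => p z.2 + z.1 • v z.2) (g := Φ)
        (by simpa using (hΦ e he).continuousAt) hline.continuousAt
    · filter_upwards [hnear, hmove e d he] with ε h1 h2
      exact hint ε h1 _ _ (hsub he) h2
  obtain ⟨C, hC⟩ := ((isCompact_Icc (a := -η) (b := η)).prod
    (isCompact_Icc (a := a) (b := b))).exists_bound_of_continuousOn
      (f := fun z : ℝ × ℝ => fderiv ℝ Φ (p z.2 + z.1 • v z.2) (v z.2))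
      (continuousOn_fderiv_apply_comp hline (by fun_prop) (by
        rintro ⟨ε, t⟩ ⟨h1, h2⟩
        exact hbox ε t (abs_le.2 h1) (hsub h2)))
  have hmid : HasDerivAt (fun ε : ℝ => ∫ t in a..b, Φ (p t + ε • v t))
      (∫ t in a..b, fderiv ℝ Φ (p t) (v t)) 0 := by
    have hIoc : uIoc a b ⊆ Icc a b := by rw [uIoc_of_le hab.le]; exact Ioc_subset_Icc_self
    have := (intervalIntegral.hasDerivAt_integral_of_dominated_loc_of_deriv_le (μ := volume)
      (F := fun ε t => Φ (p t + ε • v t))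
      (F' := fun ε t => fderiv ℝ Φ (p t + ε • v t) (v t)) (x₀ := 0) (a := a) (b := b)
      (bound := fun _ => C) (s := Icc (-η) η) (Icc_mem_nhds (by linarith) hη) ?_ ?_ ?_ ?_ ?_ ?_).2
    · simpa using this
    · filter_upwards [hnear] with ε hε
      exact (((hcont ε hε).mono hsub).mono hIoc).aestronglyMeasurable measurableSet_uIoc
    · exact hint 0 (by simpa using hη.le) a b ha hb
    · refine ContinuousOn.aestronglyMeasurable ?_ measurableSet_uIoc
      refine continuousOn_fderiv_apply_comp (by fun_prop) hv fun t ht => ?_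
      simpa using hΦ t (hIoc ht)
    · exact Eventually.of_forall fun t ht ε hε => hC (ε, t) ⟨hε, hIoc ht⟩
    · exact intervalIntegrable_const
    · refine Eventually.of_forall fun t ht ε hε => ?_
      have h1 : HasDerivAt (fun ε : ℝ => p t + ε • v t) (v t) ε := by
        simpa using ((hasDerivAt_id ε).smul_const (v t)).const_add (p t)
      exact HasFDerivAt.comp_hasDerivAt (f := fun ε : ℝ => p t + ε • v t) ε
        ((hbox ε t (abs_le.2 hε) (hsub (hIoc ht))).differentiableAt (by simp)).hasFDerivAt h1
  refine ((hmid.add (hend b db hb')).sub (hend a da ha')).congr_of_eventuallyEq ?_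
  filter_upwards [hnear, hmove a da ha', hmove b db hb'] with ε h1 h2 h3
  simp only [Pi.add_apply, Pi.sub_apply]
  rw [intervalIntegral.integral_add_adjacent_intervals (hint ε h1 _ _ ha hb) (hint ε h1 _ _ hb h3),
    intervalIntegral.integral_interval_sub_left (hint ε h1 _ _ ha h3) (hint ε h1 _ _ ha h2)]

/-- The fundamental lemma of the calculus of variations. -/
theorem eq_zero_of_integral_dotProduct_eq_zero {ι : Type*} [Fintype ι] [DecidableEq ι]
    {a b : ℝ} (hab : a < b) {h : ℝ → ι → ℝ} (hh : ContinuousOn h (Icc a b))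
    (H : ∀ φ : ℝ → ι → ℝ, ContDiff ℝ 1 φ → φ a = 0 → φ b = 0 →
      ∫ t in a..b, h t ⬝ᵥ φ t = 0) : ∀ t ∈ Icc a b, h t = 0 := by
  have hi : ∀ i, ContinuousOn (fun t => h t i) (Icc a b) := fun i =>
    (continuous_apply i).comp_continuousOn hh
  have hIoo : ∀ i, ∀ t ∈ Ioo a b, h t i = 0 := by
    intro i
    have hae : ∀ᵐ t ∂(volume : Measure ℝ), t ∈ Ioo a b → h t i = 0 := by
      refine isOpen_Ioo.ae_eq_zero_of_integral_contDiff_smul_eq_zero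
        (((hi i).mono Ioo_subset_Icc_self).locallyIntegrableOn measurableSet_Ioo) ?_
      intro g hg _ hsupp
      have hzero : ∀ t, t ∉ Ioo a b → g t = 0 := fun t ht =>
        image_eq_zero_of_notMem_tsupport fun h' => ht (hsupp h')
      have := H (fun t => Pi.single i (g t)) ?_ ?_ ?_
      · simp only [dotProduct_single] at this
        rw [intervalIntegral.integral_of_le hab.le, integral_Ioc_eq_integral_Ioo] at this
        rw [← setIntegral_eq_integral_of_forall_compl_eq_zero (s := Ioo a b)
          (fun t ht => by rw [hzero t ht, zero_smul]), ← this]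
        simp only [smul_eq_mul, mul_comm]
      · refine contDiff_pi.2 fun j => ?_
        by_cases hj : j = i
        · subst hj
          simpa using hg.of_le (by exact_mod_cast le_top)
        · simpa [Pi.single_apply, hj] using contDiff_const
      · simp [hzero a (by simp)]
      · simp [hzero b (by simp)]
    have hae' : (fun t => h t i) =ᵐ[volume.restrict (Ioo a b)] fun _ => 0 :=
      (ae_restrict_iff' measurableSet_Ioo).2 hae
    exact Measure.eqOn_open_of_ae_eq hae' isOpen_Ioo ((hi i).mono Ioo_subset_Icc_self)
      continuousOn_const
  intro t ht
  funext i
  have hcl : Icc a b ⊆ closure (Ioo a b) := (closure_Ioo hab.ne).ge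
  exact (Set.EqOn.of_subset_closure (f := fun t => h t i) (g := fun _ => 0)
    (fun t ht => hIoo i t ht) (hi i) continuousOn_const Ioo_subset_Icc_self hcl) ht

end

section

/-! ### Smoothness of vector and quaternion operations -/

variable {E : Type*} [NormedAddCommGroup E] [NormedSpace ℝ E] {m : ℕ∞ω} {e : E}

theorem contDiffAt_crossProduct {v w : E → Fin 3 → ℝ} (hv : ContDiffAt ℝ m v e)
    (hw : ContDiffAt ℝ m w e) : ContDiffAt ℝ m (fun e => v e ⨯₃ w e) e := by
  have hv' := contDiffAt_pi.1 hv
  have hw' := contDiffAt_pi.1 hw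
  refine contDiffAt_pi.2 fun i => ?_
  fin_cases i <;> simp only [cross_apply] <;>
    exact ((hv' _).mul (hw' _)).sub ((hv' _).mul (hw' _))

theorem contDiffAt_dotProduct {ι : Type*} [Fintype ι] {v w : E → ι → ℝ}
    (hv : ContDiffAt ℝ m v e) (hw : ContDiffAt ℝ m w e) :
    ContDiffAt ℝ m (fun e => v e ⬝ᵥ w e) e :=
  ContDiffAt.sum fun i _ => (contDiffAt_pi.1 hv i).mul (contDiffAt_pi.1 hw i)

theorem contDiffAt_mulVec {ι κ : Type*} [Fintype ι] [Fintype κ] {A : E → Matrix ι κ ℝ}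
    {w : E → κ → ℝ} (hA : ∀ i j, ContDiffAt ℝ m (fun e => A e i j) e)
    (hw : ContDiffAt ℝ m w e) : ContDiffAt ℝ m (fun e => A e *ᵥ w e) e :=
  contDiffAt_pi.2 fun i => ContDiffAt.sum fun j _ => (hA i j).mul (contDiffAt_pi.1 hw j)

theorem contDiffAt_inv_fin_three {A : E → Matrix (Fin 3) (Fin 3) ℝ}
    (hA : ∀ i j, ContDiffAt ℝ m (fun e => A e i j) e) (h0 : (A e).det ≠ 0) (i j : Fin 3) :
    ContDiffAt ℝ m (fun e => (A e)⁻¹ i j) e := by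
  simp only [Matrix.inv_def, Ring.inverse_eq_inv', Matrix.smul_apply, smul_eq_mul]
  refine ContDiffAt.mul ?_ ?_
  · refine ContDiffAt.fun_inv ?_ h0
    simp only [Matrix.det_fin_three]
    fun_prop
  · simp only [Matrix.adjugate_fin_three]
    fin_cases i <;> fin_cases j <;> simp <;> fun_prop

theorem contDiffAt_hat {v : E → Fin 3 → ℝ} (hv : ContDiffAt ℝ m v e) (i j : Fin 3) :
    ContDiffAt ℝ m (fun e => hat (v e) i j) e := by
  have hv' := contDiffAt_pi.1 hv
  fin_cases i <;> fin_cases j <;> simp [hat] <;> fun_prop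

/-- `v♯` as a linear map. -/
def sharpₗ : (Fin 3 → ℝ) →ₗ[ℝ] ℍ[ℝ] where
  toFun := sharp
  map_add' v w := by
    ext
    · exact (add_zero (0 : ℝ)).symm
    all_goals rfl
  map_smul' c v := by
    ext
    · exact (mul_zero c).symm
    all_goals rfl

/-- The real part of a quaternion as a linear map. -/
def quatReₗ : ℍ[ℝ] →ₗ[ℝ] ℝ where
  toFun q := q.re
  map_add' _ _ := rfl
  map_smul' _ _ := rfl

/-- `p♭` as a linear map. -/
def flatₗ : ℍ[ℝ] →ₗ[ℝ] (Fin 3 → ℝ) where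
  toFun := flat
  map_add' v w := by funext i; fin_cases i <;> simp [flat]
  map_smul' c v := by funext i; fin_cases i <;> simp [flat]

/-- The block `𝔮` of a state as a linear map. -/
def quatₗ (n : ℕ) : State n →ₗ[ℝ] ℍ[ℝ] where
  toFun := quat
  map_add' v w := by ext <;> rfl
  map_smul' c v := by ext <;> rfl

theorem contDiff_sharp : ContDiff ℝ m sharp :=
  (LinearMap.toContinuousLinearMap sharpₗ).contDiff

theorem contDiff_flat : ContDiff ℝ m flat :=
  (LinearMap.toContinuousLinearMap flatₗ).contDiff

theorem contDiff_quat {n : ℕ} : ContDiff ℝ m (quat (n := n)) :=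
  (LinearMap.toContinuousLinearMap (quatₗ n)).contDiff

theorem contDiffAt_quaternion_inv {q : E → ℍ[ℝ]} (hq : ContDiffAt ℝ m q e) (h0 : q e ≠ 0) :
    ContDiffAt ℝ m (fun e => (q e)⁻¹) e := by
  have h := contDiffAt_ringInverse ℝ (n := m) (Units.mk0 (q e) h0)
  rw [Ring.inverse_eq_inv'] at h
  exact ContDiffAt.comp (f := q) (g := Inv.inv) e h hq

/-! ### Smoothness of the blocks of a state -/

variable {n : ℕ} {X : E → State n}

theorem contDiff_theta : ContDiff ℝ m (theta (n := n)) :=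
  contDiff_pi.2 fun _ => contDiff_apply _ _ _

theorem contDiff_dtheta : ContDiff ℝ m (dtheta (n := n)) :=
  contDiff_pi.2 fun _ => contDiff_apply _ _ _

theorem contDiff_Omega : ContDiff ℝ m (Omega (n := n)) :=
  contDiff_pi.2 fun _ => contDiff_apply _ _ _

theorem contDiff_zpos : ContDiff ℝ m (zpos (n := n)) :=
  contDiff_pi.2 fun _ => contDiff_apply _ _ _

theorem contDiffAt_mkState {th dth : E → Fin n → ℝ} {q : E → ℍ[ℝ]} {Om : E → Fin 3 → ℝ}
    {z : E → Fin 2 → ℝ} (hth : ContDiffAt ℝ m th e) (hdth : ContDiffAt ℝ m dth e)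
    (hq : ContDiffAt ℝ m q e) (hOm : ContDiffAt ℝ m Om e) (hz : ContDiffAt ℝ m z e) :
    ContDiffAt ℝ m (fun e => mkState (th e) (dth e) (q e) (Om e) (z e)) e := by
  refine contDiffAt_pi.2 fun i => ?_
  rcases i with i | i | i | i | i
  · exact contDiffAt_pi.1 hth i
  · exact contDiffAt_pi.1 hdth i
  · have hre : ContDiffAt ℝ m (fun e => (q e).re) e :=
      ContDiffAt.comp (g := fun q : ℍ[ℝ] => q.re) e (LinearMap.toContinuousLinearMap
        quatReₗ).contDiff.contDiffAt hq
    have hfl := contDiffAt_pi.1 (contDiff_flat.contDiffAt.comp e hq)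
    fin_cases i
    · exact hre
    · exact hfl 0
    · exact hfl 1
    · exact hfl 2
  · exact contDiffAt_pi.1 hOm i
  · exact contDiffAt_pi.1 hz i

theorem contDiffAt_flat_inv_mul_sharp_mul {v : E → Fin 3 → ℝ} (hX : ContDiffAt ℝ m X e)
    (hv : ContDiffAt ℝ m v e) (h0 : quat (X e) ≠ 0) :
    ContDiffAt ℝ m (fun e => flat ((quat (X e))⁻¹ * sharp (v e) * quat (X e))) e := by
  have hq := contDiff_quat.contDiffAt.comp e hX
  exact contDiff_flat.contDiffAt.comp e (((contDiffAt_quaternion_inv hq h0).mul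
    (contDiff_sharp.contDiffAt.comp e hv)).mul hq)

theorem contDiffAt_flat_mul_sharp_mul_inv {v : E → Fin 3 → ℝ} (hX : ContDiffAt ℝ m X e)
    (hv : ContDiffAt ℝ m v e) (h0 : quat (X e) ≠ 0) :
    ContDiffAt ℝ m (fun e => flat (quat (X e) * sharp (v e) * (quat (X e))⁻¹)) e := by
  have hq := contDiff_quat.contDiffAt.comp e hX
  exact contDiff_flat.contDiffAt.comp e ((hq.mul
    (contDiff_sharp.contDiffAt.comp e hv)).mul (contDiffAt_quaternion_inv hq h0))

theorem contDiffAt_Gam (hX : ContDiffAt ℝ m X e) (h0 : quat (X e) ≠ 0) :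
    ContDiffAt ℝ m (fun e => Problem.Gam (X e)) e :=
  contDiffAt_flat_inv_mul_sharp_mul hX contDiffAt_const h0

theorem contDiffAt_ext0 {w : E → Fin n → ℝ} (hw : ContDiffAt ℝ m w e) (i : Fin (n + 1)) :
    ContDiffAt ℝ m (fun e => Problem.ext0 (w e) i) e := by
  refine Fin.cases ?_ (fun i => ?_) i
  · exact contDiffAt_const
  · exact contDiffAt_pi.1 hw i

namespace Problem

variable {K k : ℕ} (P : Problem n K k)

/-! ### Invertibility of the mass matrix -/

theorem hat_mulVec (v w : Fin 3 → ℝ) : hat v *ᵥ w = v ⨯₃ w := by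
  funext i
  fin_cases i <;>
    simp [hat, cross_apply, Matrix.mulVec, dotProduct, Fin.sum_univ_three] <;> ring

theorem dotProduct_massMatrix_mulVec (x : State n) (w : Fin 3 → ℝ) :
    w ⬝ᵥ (P.massMatrix x *ᵥ w)
      = -(∑ i, P.m i * ((P.s x i ⨯₃ w) ⬝ᵥ (P.s x i ⨯₃ w)) + ∑ j, P.d j * w j ^ 2) := by
  have h : ∀ v : Fin 3 → ℝ, w ⬝ᵥ ((hat v * hat v) *ᵥ w) = -((v ⨯₃ w) ⬝ᵥ (v ⨯₃ w)) := by
    intro v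
    rw [← Matrix.mulVec_mulVec, hat_mulVec, hat_mulVec]
    simp only [cross_apply, dotProduct, Fin.sum_univ_three, Matrix.cons_val]
    ring
  rw [massMatrix, Matrix.sub_mulVec, dotProduct_sub, Matrix.sum_mulVec, dotProduct_sum, neg_add,
    sub_eq_add_neg, ← Finset.sum_neg_distrib]
  congr 1
  · refine Finset.sum_congr rfl fun i _ => ?_
    rw [Matrix.smul_mulVec, dotProduct_smul, h, smul_eq_mul, mul_neg]
  · rw [inertia, neg_inj]
    exact Finset.sum_congr rfl fun j _ => by rw [Matrix.mulVec_diagonal]; ring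

theorem isUnit_massMatrix (x : State n) : IsUnit (P.massMatrix x) := by
  rw [← Matrix.mulVec_injective_iff_isUnit]
  refine (injective_iff_map_eq_zero (P.massMatrix x).mulVecLin).2 fun w hw => ?_
  rw [Matrix.mulVecLin_apply] at hw
  have h := P.dotProduct_massMatrix_mulVec x w
  rw [hw, dotProduct_zero, eq_comm, neg_eq_zero] at h
  have h1 : 0 ≤ ∑ i, P.m i * ((P.s x i ⨯₃ w) ⬝ᵥ (P.s x i ⨯₃ w)) :=
    Finset.sum_nonneg fun i _ => mul_nonneg (P.m_pos i).le
      (Finset.sum_nonneg fun j _ => mul_self_nonneg _)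
  have h2 : ∀ j ∈ Finset.univ, 0 ≤ P.d j * w j ^ 2 := fun j _ =>
    mul_nonneg (P.d_pos j).le (sq_nonneg _)
  have h3 : ∑ j, P.d j * w j ^ 2 = 0 := by linarith [Finset.sum_nonneg h2]
  funext j
  have := (Finset.sum_eq_zero_iff_of_nonneg h2).1 h3 j (Finset.mem_univ j)
  simpa [(P.d_pos j).ne'] using this

theorem det_massMatrix_ne_zero (x : State n) : (P.massMatrix x).det ≠ 0 :=
  ((Matrix.isUnit_iff_isUnit_det _).1 (P.isUnit_massMatrix x)).ne_zero

/-! ### Smoothness of the dynamics and of the cost -/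

theorem contDiff_zeta (i : Fin (n + 1)) : ContDiff ℝ 3 (P.zeta i) := by
  refine Fin.cases ?_ (fun i => ?_) i
  · exact contDiff_const
  · exact P.rail_smooth i

theorem contDiff_deriv_zeta (i : Fin (n + 1)) : ContDiff ℝ 2 (deriv (P.zeta i)) :=
  (contDiff_succ_iff_deriv (n := 2).1 (P.contDiff_zeta i)).2.2

theorem contDiff_deriv_deriv_zeta (i : Fin (n + 1)) : ContDiff ℝ 1 (deriv (deriv (P.zeta i))) :=
  (contDiff_succ_iff_deriv (n := 1).1 (P.contDiff_deriv_zeta i)).2.2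

theorem contDiffAt_zetaAt (hX : ContDiffAt ℝ 1 X e) (i : Fin (n + 1)) :
    ContDiffAt ℝ 1 (fun e => P.zetaAt (X e) i) e :=
  ((P.contDiff_zeta i).of_le (by norm_num)).contDiffAt.comp e
    (contDiffAt_ext0 (contDiff_theta.contDiffAt.comp e hX) i)

theorem contDiffAt_dzetaAt (hX : ContDiffAt ℝ 1 X e) (i : Fin (n + 1)) :
    ContDiffAt ℝ 1 (fun e => P.dzetaAt (X e) i) e :=
  ((P.contDiff_deriv_zeta i).of_le (by norm_num)).contDiffAt.comp e
    (contDiffAt_ext0 (contDiff_theta.contDiffAt.comp e hX) i)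

theorem contDiffAt_ddzetaAt (hX : ContDiffAt ℝ 1 X e) (i : Fin (n + 1)) :
    ContDiffAt ℝ 1 (fun e => P.ddzetaAt (X e) i) e :=
  (P.contDiff_deriv_deriv_zeta i).contDiffAt.comp e
    (contDiffAt_ext0 (contDiff_theta.contDiffAt.comp e hX) i)

theorem contDiffAt_s (hX : ContDiffAt ℝ 1 X e) (h0 : quat (X e) ≠ 0) (i : Fin (n + 1)) :
    ContDiffAt ℝ 1 (fun e => P.s (X e) i) e :=
  ((contDiffAt_Gam hX h0).const_smul P.r).add (P.contDiffAt_zetaAt hX i)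

theorem contDiffAt_massMatrix_inv (hX : ContDiffAt ℝ 1 X e) (h0 : quat (X e) ≠ 0) (i j : Fin 3) :
    ContDiffAt ℝ 1 (fun e => (P.massMatrix (X e))⁻¹ i j) e := by
  refine contDiffAt_inv_fin_three (A := fun e => P.massMatrix (X e)) (fun i j => ?_) (P.det_massMatrix_ne_zero _) i j
  simp only [massMatrix, Matrix.sub_apply, Matrix.sum_apply, Matrix.smul_apply, Matrix.mul_apply,
    smul_eq_mul]
  have hs := fun l => contDiffAt_hat (P.contDiffAt_s hX h0 l)
  exact ContDiffAt.sub (ContDiffAt.sum fun l _ => contDiffAt_const.mul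
    (ContDiffAt.sum fun a _ => (hs l _ _).mul (hs l _ _))) contDiffAt_const

/-- `κ` as a function of the value of the external force. -/
def kappaOfForce (F : Fin 3 → ℝ) (x : State n) (u : Control n) : Fin 3 → ℝ :=
  (P.massMatrix x)⁻¹ *ᵥ
    (Omega x ⨯₃ (P.inertia *ᵥ Omega x)
      + P.r • (flat ((quat x)⁻¹ * sharp F * quat x) ⨯₃ Gam x)
      + ∑ i, P.m i • (P.s x i ⨯₃
          (P.g • Gam x
            + Omega x ⨯₃ (Omega x ⨯₃ P.zetaAt x i + (2 * ext0 (dtheta x) i) • P.dzetaAt x i)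
            + (ext0 (dtheta x) i) ^ 2 • P.ddzetaAt x i
            + ext0 u i • P.dzetaAt x i)))

/-- `f` as a function of the value of the external force. -/
def fOfForce (F : Fin 3 → ℝ) (x : State n) (u : Control n) : State n :=
  mkState (dtheta x) u ((1 / 2 : ℝ) • (quat x * sharp (Omega x))) (P.kappaOfForce F x u) (P.zdot x)

/-- The part of `L` without the obstacle functions, as a function of the value of the desired
path. -/
def smoothCost (zd : Fin 2 → ℝ) (x : State n) (u : Control n) : ℝ :=
  P.α / 2 * ((zpos x - zd) ⬝ᵥ (zpos x - zd)) + P.β / 2 * (P.zdot x ⬝ᵥ P.zdot x)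
    + ∑ i, P.γ i / 2 * u i ^ 2 + P.δ

theorem f_eq (t : ℝ) (x : State n) (u : Control n) : P.f t x u = P.fOfForce (P.Fe t) x u := rfl

theorem L_eq (μ t : ℝ) (x : State n) (u : Control n) :
    P.L μ t x u = P.smoothCost (P.zd t) x u + ∑ j, P.V j (zpos x) μ := by
  rw [L, smoothCost]; ring

variable {U : E → Control n}

theorem contDiffAt_kappaOfForce {F : E → Fin 3 → ℝ} (hF : ContDiffAt ℝ 1 F e)
    (hX : ContDiffAt ℝ 1 X e) (hU : ContDiffAt ℝ 1 U e) (h0 : quat (X e) ≠ 0) :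
    ContDiffAt ℝ 1 (fun e => P.kappaOfForce (F e) (X e) (U e)) e := by
  have hG := contDiffAt_Gam hX h0
  have hO : ContDiffAt ℝ 1 (fun e => Omega (X e)) e := contDiff_Omega.contDiffAt.comp e hX
  have hd : ∀ i, ContDiffAt ℝ 1 (fun e => ext0 (dtheta (X e)) i) e :=
    contDiffAt_ext0 (contDiff_dtheta.contDiffAt.comp e hX)
  have hu := contDiffAt_ext0 hU
  have h1 : ContDiffAt ℝ 1 (fun e => Omega (X e) ⨯₃ (P.inertia *ᵥ Omega (X e))) e :=
    contDiffAt_crossProduct hO (contDiffAt_mulVec (fun _ _ => contDiffAt_const) hO)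
  have h2 : ContDiffAt ℝ 1 (fun e => P.r • (flat ((quat (X e))⁻¹ * sharp (F e) * quat (X e))
      ⨯₃ Gam (X e))) e :=
    (contDiffAt_crossProduct (contDiffAt_flat_inv_mul_sharp_mul hX hF h0) hG).const_smul P.r
  have h3 : ∀ i, ContDiffAt ℝ 1 (fun e => Omega (X e) ⨯₃ (Omega (X e) ⨯₃ P.zetaAt (X e) i
      + (2 * ext0 (dtheta (X e)) i) • P.dzetaAt (X e) i)) e := fun i =>
    contDiffAt_crossProduct hO ((contDiffAt_crossProduct hO (P.contDiffAt_zetaAt hX i)).add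
      ((contDiffAt_const.mul (hd i)).smul (P.contDiffAt_dzetaAt hX i)))
  have h4 : ∀ i, ContDiffAt ℝ 1
      (fun e => (ext0 (dtheta (X e)) i) ^ 2 • P.ddzetaAt (X e) i) e := fun i =>
    ((hd i).pow 2).smul (P.contDiffAt_ddzetaAt hX i)
  have h5 : ∀ i, ContDiffAt ℝ 1 (fun e => ext0 (U e) i • P.dzetaAt (X e) i) e := fun i =>
    (hu i).smul (P.contDiffAt_dzetaAt hX i)
  exact contDiffAt_mulVec (P.contDiffAt_massMatrix_inv hX h0) ((h1.add h2).add
    (ContDiffAt.sum fun i _ => (contDiffAt_crossProduct (P.contDiffAt_s hX h0 i)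
      ((((hG.const_smul P.g).add (h3 i)).add (h4 i)).add (h5 i))).const_smul (P.m i)))

theorem contDiffAt_zdot (hX : ContDiffAt ℝ 1 X e) (h0 : quat (X e) ≠ 0) :
    ContDiffAt ℝ 1 (fun e => P.zdot (X e)) e := by
  have h := contDiffAt_pi.1 (contDiffAt_crossProduct (contDiffAt_flat_mul_sharp_mul_inv hX
    (contDiff_Omega.contDiffAt.comp e hX) h0) (contDiffAt_const (c := P.r • e3)))
  refine contDiffAt_pi.2 fun i => ?_
  fin_cases i
  · exact h 0
  · exact h 1

theorem contDiffAt_fOfForce {F : E → Fin 3 → ℝ} (hF : ContDiffAt ℝ 1 F e)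
    (hX : ContDiffAt ℝ 1 X e) (hU : ContDiffAt ℝ 1 U e) (h0 : quat (X e) ≠ 0) :
    ContDiffAt ℝ 1 (fun e => P.fOfForce (F e) (X e) (U e)) e :=
  contDiffAt_mkState (contDiff_dtheta.contDiffAt.comp e hX) hU
    (((contDiff_quat.contDiffAt.comp e hX).mul (contDiff_sharp.contDiffAt.comp e
      (contDiff_Omega.contDiffAt.comp e hX))).const_smul (1 / 2 : ℝ))
    (P.contDiffAt_kappaOfForce hF hX hU h0) (P.contDiffAt_zdot hX h0)

theorem contDiffAt_smoothCost {Z : E → Fin 2 → ℝ} (hZ : ContDiffAt ℝ 1 Z e)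
    (hX : ContDiffAt ℝ 1 X e) (hU : ContDiffAt ℝ 1 U e) (h0 : quat (X e) ≠ 0) :
    ContDiffAt ℝ 1 (fun e => P.smoothCost (Z e) (X e) (U e)) e := by
  have hz := (contDiff_zpos.contDiffAt.comp e hX).sub hZ
  have hw := P.contDiffAt_zdot hX h0
  exact (((contDiffAt_const.mul (contDiffAt_dotProduct hz hz)).add
    (contDiffAt_const.mul (contDiffAt_dotProduct hw hw))).add
    (ContDiffAt.sum fun i _ => contDiffAt_const.mul ((contDiffAt_pi.1 hU i).pow 2))).add
    contDiffAt_const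

theorem contDiffAt_ctrl (hX : ContDiffAt ℝ 1 X e) {l : E → State n} (hl : ContDiffAt ℝ 1 l e)
    (h0 : quat (X e) ≠ 0) : ContDiffAt ℝ 1 (fun e => P.ctrl (X e) (l e)) e :=
  contDiffAt_pi.2 fun i => contDiffAt_const.mul
    ((contDiffAt_pi.1 (contDiff_dtheta.contDiffAt.comp e hl) i).add
      (contDiffAt_dotProduct (contDiff_Omega.contDiffAt.comp e hl)
        (contDiffAt_mulVec (P.contDiffAt_massMatrix_inv hX h0)
          ((contDiffAt_crossProduct (P.contDiffAt_s hX h0 _)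
            (P.contDiffAt_dzetaAt hX _)).const_smul _))))

theorem contDiffAt_psi (hX : ContDiffAt ℝ 1 X e) (h0 : quat (X e) ≠ 0) :
    ContDiffAt ℝ 1 (fun e => P.psi (X e)) e := by
  have hcom : ContDiffAt ℝ 1 (fun e => P.proj (P.comSpatial (X e)) - P.DeltaB) e := by
    refine ContDiffAt.sub ?_ contDiffAt_const
    exact (LinearMap.toContinuousLinearMap P.proj).contDiff.contDiffAt.comp e
      (contDiffAt_flat_mul_sharp_mul_inv hX ((ContDiffAt.sum fun i _ =>
        (P.contDiffAt_zetaAt hX i).const_smul (P.m i)).const_smul _) h0)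
  refine contDiffAt_pi.2 fun i => ?_
  rcases i with i | i | i | i
  · exact contDiffAt_pi.1 hcom i
  · exact (contDiffAt_pi.1 (contDiff_dtheta.contDiffAt.comp e hX) i).sub contDiffAt_const
  · exact (contDiffAt_pi.1 (contDiff_Omega.contDiffAt.comp e hX) i).sub contDiffAt_const
  · exact (contDiffAt_pi.1 (contDiff_zpos.contDiffAt.comp e hX) i).sub contDiffAt_const

end Problem

end

section

theorem mkState_sub_mkState {n : ℕ} (th dth th' dth' : Fin n → ℝ) (q q' : ℍ[ℝ])
    (Om Om' : Fin 3 → ℝ) (z z' : Fin 2 → ℝ) :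
    mkState th dth q Om z - mkState th' dth' q' Om' z'
      = mkState (th - th') (dth - dth') (q - q') (Om - Om') (z - z') := by
  funext i
  rcases i with i | i | i | i | i
  · rfl
  · rfl
  · fin_cases i <;> rfl
  · rfl
  · rfl

/-- The functional `v ↦ w ⬝ᵥ v`. -/
def dotCLM {ι : Type*} [Fintype ι] (w : ι → ℝ) : (ι → ℝ) →L[ℝ] ℝ :=
  LinearMap.toContinuousLinearMap
    { toFun := fun v => w ⬝ᵥ v
      map_add' := dotProduct_add w
      map_smul' := fun c v => dotProduct_smul c w v }

@[simp] theorem dotCLM_apply {ι : Type*} [Fintype ι] (w v : ι → ℝ) : dotCLM w v = w ⬝ᵥ v := rfl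

theorem hasFDerivAt_dotProduct_const {ι : Type*} [Fintype ι] (w y : ι → ℝ) :
    HasFDerivAt (fun v => v ⬝ᵥ w) (dotCLM w) y := by
  simp_rw [dotProduct_comm _ w]
  exact (dotCLM w).hasFDerivAt

theorem grad_const_add_dotProduct {ι : Type*} [Fintype ι] [DecidableEq ι] (c : ℝ) (w y : ι → ℝ) :
    grad (fun v => c + v ⬝ᵥ w) y = w :=
  grad_eq_of_hasFDerivAt ((hasFDerivAt_dotProduct_const w y).const_add c) fun _ => rfl

/-- The total differential of a function of three vectors by its partial gradients. -/
theorem fderiv_prod_prod_apply {ι κ τ : Type*} [Fintype ι] [DecidableEq ι] [Fintype κ]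
    [DecidableEq κ] [Fintype τ] [DecidableEq τ] {Ψ : (ι → ℝ) × (κ → ℝ) × (τ → ℝ) → ℝ}
    {x : ι → ℝ} {l : κ → ℝ} {u : τ → ℝ} (h : DifferentiableAt ℝ Ψ (x, l, u)) (dx : ι → ℝ)
    (dl : κ → ℝ) (du : τ → ℝ) :
    fderiv ℝ Ψ (x, l, u) (dx, dl, du) = grad (fun y => Ψ (y, l, u)) x ⬝ᵥ dx
      + grad (fun y => Ψ (x, y, u)) l ⬝ᵥ dl + grad (fun y => Ψ (x, l, y)) u ⬝ᵥ du := by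
  have h1 : HasFDerivAt (fun y : ι → ℝ => (y, l, u)) (ContinuousLinearMap.inl ℝ _ _) x :=
    hasFDerivAt_prodMk_left x (l, u)
  have h2 : HasFDerivAt (fun y : κ → ℝ => (x, y, u))
      ((ContinuousLinearMap.inr ℝ (ι → ℝ) ((κ → ℝ) × (τ → ℝ))).comp
        (ContinuousLinearMap.inl ℝ _ _)) l :=
    (hasFDerivAt_prodMk_right x (l, u)).comp l (hasFDerivAt_prodMk_left l u)
  have h3 : HasFDerivAt (fun y : τ → ℝ => (x, l, y))
      ((ContinuousLinearMap.inr ℝ (ι → ℝ) ((κ → ℝ) × (τ → ℝ))).comp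
        (ContinuousLinearMap.inr ℝ _ _)) u :=
    (hasFDerivAt_prodMk_right x (l, u)).comp u (hasFDerivAt_prodMk_right l u)
  have e1 := (HasFDerivAt.comp (g := Ψ) x h.hasFDerivAt h1).fderiv
  have e2 := (HasFDerivAt.comp (g := Ψ) l h.hasFDerivAt h2).fderiv
  have e3 := (HasFDerivAt.comp (g := Ψ) u h.hasFDerivAt h3).fderiv
  simp only [Function.comp_def] at e1 e2 e3
  rw [← fderiv_apply_eq_grad_dotProduct, ← fderiv_apply_eq_grad_dotProduct,
    ← fderiv_apply_eq_grad_dotProduct, e1, e2, e3]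
  simp only [ContinuousLinearMap.comp_apply, ContinuousLinearMap.inl_apply,
    ContinuousLinearMap.inr_apply, ← map_add, Prod.mk_add_mk, add_zero, zero_add]

namespace Problem

variable {n K k : ℕ} (P : Problem n K k)

/-- The coefficient of `u_i` in `λᵀ f`. -/
def controlCoeff (x lam : State n) (i : Fin n) : ℝ :=
  dtheta lam i
    + Omega lam ⬝ᵥ ((P.massMatrix x)⁻¹ *ᵥ (P.m i.succ • (P.s x i.succ ⨯₃ P.dzetaAt x i.succ)))

/-- `controlCoeff` as a linear functional of the costate. -/
def controlCoeffCLM (x : State n) (i : Fin n) : State n →L[ℝ] ℝ :=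
  LinearMap.toContinuousLinearMap
    { toFun := fun lam => P.controlCoeff x lam i
      map_add' := fun l l' => by
        have h : Omega (l + l') = Omega l + Omega l' := rfl
        have h' : dtheta (l + l') i = dtheta l i + dtheta l' i := rfl
        simp only [controlCoeff, h, h', add_dotProduct]
        ring
      map_smul' := fun c l => by
        have h : Omega (c • l) = c • Omega l := rfl
        have h' : dtheta (c • l) i = c * dtheta l i := rfl
        simp only [controlCoeff, h, h', smul_dotProduct, smul_eq_mul, RingHom.id_apply]
        ring }

@[simp] theorem controlCoeffCLM_apply (x lam : State n) (i : Fin n) :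
    P.controlCoeffCLM x i lam = P.controlCoeff x lam i := rfl

theorem kappa_eq (t : ℝ) (x : State n) (u : Control n) :
    P.kappa t x u = P.kappa t x 0 + ∑ i, u i •
      ((P.massMatrix x)⁻¹ *ᵥ (P.m i.succ • (P.s x i.succ ⨯₃ P.dzetaAt x i.succ))) := by
  simp only [kappa, ← Matrix.mulVec_smul, ← Matrix.mulVec_sum, ← Matrix.mulVec_add]
  congr 1
  rw [add_assoc (_ + _), add_right_inj]
  have h0 : ext0 u 0 = 0 := rfl
  have h0' : ∀ i : Fin (n + 1), ext0 (0 : Fin n → ℝ) i = 0 := fun i => by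
    refine Fin.cases ?_ (fun _ => ?_) i <;> rfl
  have h1 : ∀ i : Fin n, ext0 u i.succ = u i := fun i => rfl
  rw [Fin.sum_univ_succ, Fin.sum_univ_succ, h0]
  simp only [h0', h1]
  rw [add_assoc (P.m 0 • _), add_right_inj, ← Finset.sum_add_distrib]
  refine Finset.sum_congr rfl fun i _ => ?_
  simp only [map_add, map_smul, smul_add, zero_smul, add_zero]
  rw [smul_comm (P.m i.succ) (u i)]

theorem dotProduct_f (t : ℝ) (x lam : State n) (u : Control n) :
    lam ⬝ᵥ P.f t x u = lam ⬝ᵥ P.f t x 0 + ∑ i, P.controlCoeff x lam i * u i := by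
  have h : P.f t x u - P.f t x 0 = mkState 0 u 0 (P.kappa t x u - P.kappa t x 0) 0 := by
    rw [f, f, mkState_sub_mkState, sub_self, sub_self, sub_self, sub_zero]
  rw [← sub_eq_iff_eq_add', ← dotProduct_sub, h, kappa_eq, add_sub_cancel_left]
  have h' : ∀ (w : Fin n → ℝ) (v : Fin 3 → ℝ),
      lam ⬝ᵥ mkState 0 w 0 v 0 = dtheta lam ⬝ᵥ w + Omega lam ⬝ᵥ v := by
    intro w v
    simp [dotProduct, mkState, dtheta, Omega, Fintype.sum_sum_type, Fin.sum_univ_four]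
  rw [h', dotProduct_sum]
  simp only [controlCoeff, add_mul, Finset.sum_add_distrib, dotProduct_smul, smul_eq_mul]
  exact congrArg₂ _ rfl (Finset.sum_congr rfl fun i _ => mul_comm _ _)

theorem H_eq_quadratic (μ t : ℝ) (x lam : State n) (u : Control n) :
    P.H μ t x lam u = P.H μ t x lam 0
      + ∑ i, (P.γ i / 2 * u i ^ 2 + P.controlCoeff x lam i * u i) := by
  rw [H, H, dotProduct_f, Finset.sum_add_distrib, L, L]
  simp only [Pi.zero_apply]
  ring_nf
  simp

theorem contDiff_H_control (μ t : ℝ) (x lam : State n) :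
    ContDiff ℝ ∞ (fun w => P.H μ t x lam w) := by
  rw [funext (P.H_eq_quadratic μ t x lam)]
  fun_prop

theorem Hu_eq (μ t : ℝ) (x lam : State n) (u : Control n) :
    P.Hu μ t x lam u = fun i => P.γ i * u i + P.controlCoeff x lam i := by
  have h : HasFDerivAt (fun w => P.H μ t x lam w)
      (∑ i, ((P.γ i * u i + P.controlCoeff x lam i) •
        (ContinuousLinearMap.proj i : (Fin n → ℝ) →L[ℝ] ℝ))) u := by
    rw [funext (P.H_eq_quadratic μ t x lam)]
    refine HasFDerivAt.const_add _ (HasFDerivAt.fun_sum fun i _ => ?_)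
    have hp : HasFDerivAt (fun w : Fin n → ℝ => w i) (ContinuousLinearMap.proj i) u :=
      (ContinuousLinearMap.proj (R := ℝ) (φ := fun _ : Fin n => ℝ) i).hasFDerivAt
    refine (((hp.pow 2).const_mul (P.γ i / 2)).add
      (hp.const_mul (P.controlCoeff x lam i))).congr_fderiv ?_
    ext v
    simp
    ring
  refine grad_eq_of_hasFDerivAt h fun v => ?_
  simp [dotProduct]

theorem Huu_eq (μ t : ℝ) (x lam : State n) (u : Control n) :
    P.Huu μ t x lam u = Matrix.diagonal P.γ := by
  ext i j
  have h : HasFDerivAt (fun w : Control n => P.Hu μ t x lam w i)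
      (P.γ i • (ContinuousLinearMap.proj i : (Fin n → ℝ) →L[ℝ] ℝ)) u := by
    simp_rw [Hu_eq]
    have hp : HasFDerivAt (fun w : Fin n → ℝ => w i) (ContinuousLinearMap.proj i) u :=
      (ContinuousLinearMap.proj (R := ℝ) (φ := fun _ : Fin n => ℝ) i).hasFDerivAt
    exact (hp.const_mul (P.γ i)).add_const _
  change fderiv ℝ (fun w : Control n => P.Hu μ t x lam w i) u (Pi.single j 1) = _
  rw [h.fderiv, Matrix.diagonal_apply]
  simp [Pi.single_apply]

theorem posDef_Huu_iff (μ t : ℝ) (x lam : State n) (u : Control n) :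
    (P.Huu μ t x lam u).PosDef ↔ ∀ i, 0 < P.γ i := by
  rw [Huu_eq, Matrix.posDef_diagonal_iff]

theorem isRegular_iff : P.IsRegular ↔ ∀ i, 0 < P.γ i := by
  simp only [IsRegular, Huu_eq, Matrix.isUnit_diagonal, Pi.isUnit_iff, isUnit_iff_ne_zero,
    forall_const]
  exact forall_congr' fun i => ⟨fun h => (P.γ_nonneg i).lt_of_ne' h, fun h => h.ne'⟩

variable {P}

theorem Hu_apply_eq_zero_iff (hP : P.IsRegular) (μ t : ℝ) (x lam : State n) (u : Control n)
    (i : Fin n) : P.Hu μ t x lam u i = 0 ↔ u i = P.ctrl x lam i := by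
  have hγ := (P.isRegular_iff.1 hP i).ne'
  rw [Hu_eq]
  change P.γ i * u i + P.controlCoeff x lam i = 0 ↔ u i = -(P.γ i)⁻¹ * P.controlCoeff x lam i
  constructor
  · intro h
    field_simp
    linarith
  · intro h
    rw [h]
    field_simp
    ring

theorem Hu_eq_zero_iff (hP : P.IsRegular) (μ t : ℝ) (x lam : State n) (u : Control n) :
    P.Hu μ t x lam u = 0 ↔ u = P.ctrl x lam := by
  simp only [funext_iff, Pi.zero_apply, Hu_apply_eq_zero_iff hP]

variable (P)

/-! ### Derivatives in the costate, the state, and the multipliers -/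

theorem hasFDerivAt_H_costate (μ t : ℝ) (x lam : State n) (u : Control n) :
    HasFDerivAt (fun l => P.H μ t x l u) (dotCLM (P.f t x u)) lam :=
  (hasFDerivAt_dotProduct_const _ _).const_add _

theorem grad_H_costate (μ t : ℝ) (x lam : State n) (u : Control n) :
    grad (fun l => P.H μ t x l u) lam = P.f t x u :=
  grad_const_add_dotProduct _ _ _

theorem grad_G_xi (a b : ℝ) (xa xb xi : State n) (nu : FinalIdx n k → ℝ) :
    grad (fun y => P.G a xa y b xb nu) xi = P.sigma xa :=
  grad_eq_of_hasFDerivAt (((hasFDerivAt_dotProduct_const _ _).const_add _).add_const _)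
    fun _ => rfl

theorem grad_G_nu (a b : ℝ) (xa xb xi : State n) (nu : FinalIdx n k → ℝ) :
    grad (fun y => P.G a xa xi b xb y) nu = P.psi xb :=
  grad_const_add_dotProduct _ _ _

theorem grad_G_xa (a b : ℝ) (xa xb xi : State n) (nu : FinalIdx n k → ℝ) :
    grad (fun y => P.G a y xi b xb nu) xa = xi := by
  have h : HasFDerivAt (fun y => xi ⬝ᵥ P.sigma y) (dotCLM xi) xa :=
    (dotCLM xi).hasFDerivAt.comp xa ((hasFDerivAt_id xa).sub_const _)
  exact grad_eq_of_hasFDerivAt ((h.const_add _).add_const _) fun _ => rfl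

theorem grad_G_xb_dotProduct (a b : ℝ) (xa xb xi : State n) (nu : FinalIdx n k → ℝ)
    (h0 : quat xb ≠ 0) (v : State n) :
    grad (fun y => P.G a xa xi b y nu) xb ⬝ᵥ v = nu ⬝ᵥ fderiv ℝ P.psi xb v := by
  have h1 : HasFDerivAt P.psi (fderiv ℝ P.psi xb) xb :=
    ((P.contDiffAt_psi contDiffAt_id h0).differentiableAt (by simp)).hasFDerivAt
  have h : HasFDerivAt (fun y => nu ⬝ᵥ P.psi y) ((dotCLM nu).comp (fderiv ℝ P.psi xb)) xb :=
    HasFDerivAt.comp (g := dotCLM nu) xb (dotCLM nu).hasFDerivAt h1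
  have h2 : HasFDerivAt (fun y => P.G a xa xi b y nu) ((dotCLM nu).comp (fderiv ℝ P.psi xb)) xb :=
    h.const_add _
  rw [← fderiv_apply_eq_grad_dotProduct, h2.fderiv]
  rfl

theorem differentiableAt_H (μ t : ℝ) {x : State n} (lam : State n) (u : Control n)
    (h0 : quat x ≠ 0) (hV : ∀ j, DifferentiableAt ℝ (fun z => P.V j z μ) (zpos x)) :
    DifferentiableAt ℝ (fun w : State n × State n × Control n => P.H μ t w.1 w.2.1 w.2.2)
      (x, lam, u) := by
  have hX : ContDiffAt ℝ 1 (fun w : State n × State n × Control n => w.1) (x, lam, u) :=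
    contDiffAt_fst
  have hl : ContDiffAt ℝ 1 (fun w : State n × State n × Control n => w.2.1) (x, lam, u) := by
    fun_prop
  have hu : ContDiffAt ℝ 1 (fun w : State n × State n × Control n => w.2.2) (x, lam, u) := by
    fun_prop
  simp only [H, L_eq, f_eq]
  refine DifferentiableAt.add (DifferentiableAt.add ?_ (DifferentiableAt.fun_sum fun j _ => ?_)) ?_
  · exact (P.contDiffAt_smoothCost contDiffAt_const hX hu h0).differentiableAt (by simp)
  · exact DifferentiableAt.comp (g := fun z => P.V j z μ)
      (f := fun w : State n × State n × Control n => zpos w.1) (x, lam, u) (hV j)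
      ((contDiff_zpos.contDiffAt.comp _ hX).differentiableAt (by simp : (1 : ℕ∞ω) ≠ 0))
  · exact (contDiffAt_dotProduct hl
      (P.contDiffAt_fOfForce contDiffAt_const hX hu h0)).differentiableAt (by simp)

theorem fderiv_H_apply (μ t : ℝ) {x : State n} (lam : State n) (u : Control n)
    (h0 : quat x ≠ 0) (hV : ∀ j, DifferentiableAt ℝ (fun z => P.V j z μ) (zpos x))
    (dx dl : State n) (du : Control n) :
    fderiv ℝ (fun w : State n × State n × Control n => P.H μ t w.1 w.2.1 w.2.2) (x, lam, u)
      (dx, dl, du) = grad (fun y => P.H μ t y lam u) x ⬝ᵥ dx + P.f t x u ⬝ᵥ dl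
        + P.Hu μ t x lam u ⬝ᵥ du := by
  rw [fderiv_prod_prod_apply (P.differentiableAt_H μ t lam u h0 hV)]
  simp only [grad_H_costate]
  rfl

variable {P}

theorem hasFDerivAt_Hhat_costate (hP : P.IsRegular) (μ t : ℝ) (x lam : State n) :
    HasFDerivAt (fun l => P.Hhat μ t x l) (dotCLM (P.fhat t x lam)) lam := by
  have hγ := fun i => (P.isRegular_iff.1 hP i).ne'
  have hH : ∀ l, P.Hhat μ t x l = P.H μ t x l 0
      + ∑ i, (-(P.γ i)⁻¹ / 2) * P.controlCoeffCLM x i l ^ 2 := by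
    intro l
    rw [Hhat, H_eq_quadratic]
    congr 1
    refine Finset.sum_congr rfl fun i _ => ?_
    have hi := hγ i
    rw [show P.ctrl x l i = -(P.γ i)⁻¹ * P.controlCoeff x l i from rfl, controlCoeffCLM_apply]
    field_simp
    ring
  simp_rw [hH]
  refine ((P.hasFDerivAt_H_costate μ t x lam 0).add (HasFDerivAt.fun_sum fun i _ =>
    (((P.controlCoeffCLM x i).hasFDerivAt (x := lam)).pow 2).const_mul _)).congr_fderiv ?_
  ext1 v
  rw [dotCLM_apply, fhat, dotProduct_comm, dotProduct_f, dotProduct_comm]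
  simp only [add_apply, sum_apply, dotCLM_apply,
    add_right_inj, smul_apply, controlCoeffCLM_apply, smul_eq_mul, nsmul_eq_mul]
  refine Finset.sum_congr rfl fun i _ => ?_
  have : P.ctrl x lam i = -(P.γ i)⁻¹ * P.controlCoeff x lam i := rfl
  rw [this]
  push_cast
  ring

theorem grad_Hhat_costate (hP : P.IsRegular) (μ t : ℝ) (x lam : State n) :
    grad (fun l => P.Hhat μ t x l) lam = P.fhat t x lam :=
  grad_eq_of_hasFDerivAt (hasFDerivAt_Hhat_costate hP μ t x lam) fun _ => rfl

theorem differentiableAt_H_state (μ t : ℝ) {x : State n} (lam : State n) (u : Control n)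
    (h0 : quat x ≠ 0) (hV : ∀ j, DifferentiableAt ℝ (fun z => P.V j z μ) (zpos x)) :
    DifferentiableAt ℝ (fun y => P.H μ t y lam u) x :=
  DifferentiableAt.comp (g := fun w : State n × State n × Control n => P.H μ t w.1 w.2.1 w.2.2)
    (f := fun y => (y, lam, u)) x (P.differentiableAt_H μ t lam u h0 hV) (by fun_prop)

theorem hasFDerivAt_Hhat_state (hP : P.IsRegular) (μ t : ℝ) {x : State n} (lam : State n)
    (h0 : quat x ≠ 0) (hV : ∀ j, DifferentiableAt ℝ (fun z => P.V j z μ) (zpos x)) :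
    HasFDerivAt (fun y => P.Hhat μ t y lam)
      (dotCLM (grad (fun y => P.H μ t y lam (P.ctrl x lam)) x)) x := by
  have hc : HasFDerivAt (fun y => P.ctrl y lam) (fderiv ℝ (fun y => P.ctrl y lam) x) x :=
    ((P.contDiffAt_ctrl contDiffAt_id contDiffAt_const h0).differentiableAt (by simp)).hasFDerivAt
  have h := HasFDerivAt.comp
    (g := fun w : State n × State n × Control n => P.H μ t w.1 w.2.1 w.2.2)
    (f := fun y => (y, lam, P.ctrl y lam)) x
    (P.differentiableAt_H μ t lam (P.ctrl x lam) h0 hV).hasFDerivAt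
    ((hasFDerivAt_id x).prodMk ((hasFDerivAt_const lam x).prodMk hc))
  refine h.congr_fderiv ?_
  ext1 v
  simp only [ContinuousLinearMap.comp_apply, ContinuousLinearMap.prod_apply,
    ContinuousLinearMap.id_apply, zero_apply]
  rw [P.fderiv_H_apply μ t lam _ h0 hV, (Hu_eq_zero_iff hP μ t x lam _).2 rfl]
  simp

theorem grad_Hhat_state (hP : P.IsRegular) (μ t : ℝ) {x : State n} (lam : State n)
    (h0 : quat x ≠ 0) (hV : ∀ j, DifferentiableAt ℝ (fun z => P.V j z μ) (zpos x)) :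
    grad (fun y => P.Hhat μ t y lam) x = grad (fun y => P.H μ t y lam (P.ctrl x lam)) x :=
  grad_eq_of_hasFDerivAt (hasFDerivAt_Hhat_state hP μ t lam h0 hV) fun _ => rfl

end Problem

end

section

theorem hasDerivAt_dotProduct {ι : Type*} [Fintype ι] {v w : ℝ → ι → ℝ} {v' w' : ι → ℝ} {t : ℝ}
    (hv : HasDerivAt v v' t) (hw : HasDerivAt w w' t) :
    HasDerivAt (fun t => v t ⬝ᵥ w t) (v' ⬝ᵥ w t + v t ⬝ᵥ w') t := by
  have h : HasDerivAt (fun t => v t ⬝ᵥ w t) (∑ i, (v' i * w t i + v t i * w' i)) t :=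
    HasDerivAt.fun_sum (u := Finset.univ) fun i _ =>
      ((hasDerivAt_pi.1 hv i).mul (hasDerivAt_pi.1 hw i))
  rwa [Finset.sum_add_distrib] at h

/-- The derivative at `0` of `ε ↦ y (a + ε d) + ε w (a + ε d)`. -/
theorem hasDerivAt_add_smul_comp_add_mul {F : Type*} [NormedAddCommGroup F] [NormedSpace ℝ F]
    {y w : ℝ → F} (hy : ContDiff ℝ 1 y) (hw : ContDiff ℝ 1 w) (a d : ℝ) :
    HasDerivAt (fun ε : ℝ => y (a + ε * d) + ε • w (a + ε * d)) (d • deriv y a + w a) 0 := by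
  have h : HasDerivAt (fun ε : ℝ => a + ε * d) d 0 := by
    simpa using ((hasDerivAt_id (0 : ℝ)).mul_const d).const_add a
  have hy' : HasDerivAt y (deriv y a) (a + 0 * d) := by
    simpa using (hy.differentiable (by simp) a).hasDerivAt
  have hw' : HasDerivAt w (deriv w a) (a + 0 * d) := by
    simpa using (hw.differentiable (by simp) a).hasDerivAt
  have h' : HasDerivAt (fun ε : ℝ => y (a + ε * d) + ε • w (a + ε * d)) _ 0 :=
    (hy'.scomp 0 h).add ((hasDerivAt_id (0 : ℝ)).smul (hw'.scomp 0 h))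
  exact h'.congr_deriv (by simp)

namespace Problem

variable {n K k : ℕ} (P : Problem n K k)

/-- The arguments on which the integrands of `J̃` depend: external force, desired position, state,
costate, control, velocity of the state. -/
abbrev Jet (n : ℕ) :=
  (Fin 3 → ℝ) × (Fin 2 → ℝ) × State n × State n × Control n × State n

/-- The integrand `L` of `J̃`. -/
def costIntegrand (μ : ℝ) (w : Jet n) : ℝ :=
  P.smoothCost w.2.1 w.2.2.1 w.2.2.2.2.1 + ∑ j, P.V j (zpos w.2.2.1) μ

/-- The integrand `λᵀ (f - ẋ)` of `J̃`. -/
def dynIntegrand (w : Jet n) : ℝ :=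
  w.2.2.2.1 ⬝ᵥ (P.fOfForce w.1 w.2.2.1 w.2.2.2.2.1 - w.2.2.2.2.2)

theorem contDiffAt_costIntegrand {μ : ℝ} {w : Jet n} (h0 : quat w.2.2.1 ≠ 0)
    (hV : ∀ j, ContDiffAt ℝ 1 (fun z => P.V j z μ) (zpos w.2.2.1)) :
    ContDiffAt ℝ 1 (P.costIntegrand μ) w := by
  have hX : ContDiffAt ℝ 1 (fun w : Jet n => w.2.2.1) w := by fun_prop
  have hZ : ContDiffAt ℝ 1 (fun w : Jet n => w.2.1) w := by fun_prop
  have hU : ContDiffAt ℝ 1 (fun w : Jet n => w.2.2.2.2.1) w := by fun_prop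
  exact (P.contDiffAt_smoothCost hZ hX hU h0).add (ContDiffAt.sum fun j _ =>
    ContDiffAt.comp (g := fun z => P.V j z μ) (f := fun w : Jet n => zpos w.2.2.1) w (hV j)
      (contDiff_zpos.contDiffAt.comp w hX))

theorem contDiffAt_dynIntegrand {w : Jet n} (h0 : quat w.2.2.1 ≠ 0) :
    ContDiffAt ℝ 1 P.dynIntegrand w := by
  have hX : ContDiffAt ℝ 1 (fun w : Jet n => w.2.2.1) w := by fun_prop
  have hF : ContDiffAt ℝ 1 (fun w : Jet n => w.1) w := by fun_prop
  have hl : ContDiffAt ℝ 1 (fun w : Jet n => w.2.2.2.1) w := by fun_prop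
  have hU : ContDiffAt ℝ 1 (fun w : Jet n => w.2.2.2.2.1) w := by fun_prop
  have hY : ContDiffAt ℝ 1 (fun w : Jet n => w.2.2.2.2.2) w := by fun_prop
  exact contDiffAt_dotProduct hl ((P.contDiffAt_fOfForce hF hX hU h0).sub hY)

theorem costIntegrand_add_dynIntegrand (μ t : ℝ) (x lam : State n) (u : Control n) (y : State n) :
    P.costIntegrand μ (P.Fe t, P.zd t, x, lam, u, y)
      + P.dynIntegrand (P.Fe t, P.zd t, x, lam, u, y) = P.H μ t x lam u - lam ⬝ᵥ y := by
  rw [H, L_eq, f_eq, costIntegrand, dynIntegrand, dotProduct_sub]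
  ring

theorem fderiv_integrands_apply {μ t : ℝ} {x lam : State n} {u : Control n} {y : State n}
    (h0 : quat x ≠ 0) (hV : ∀ j, ContDiffAt ℝ 1 (fun z => P.V j z μ) (zpos x))
    (dx dl : State n) (du : Control n) (dy : State n) :
    fderiv ℝ (P.costIntegrand μ) (P.Fe t, P.zd t, x, lam, u, y) (0, 0, dx, dl, du, dy)
      + fderiv ℝ P.dynIntegrand (P.Fe t, P.zd t, x, lam, u, y) (0, 0, dx, dl, du, dy)
      = grad (fun y => P.H μ t y lam u) x ⬝ᵥ dx + (P.f t x u - y) ⬝ᵥ dl + P.Hu μ t x lam u ⬝ᵥ du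
        - lam ⬝ᵥ dy := by
  set p : Jet n := (P.Fe t, P.zd t, x, lam, u, y) with hp
  set v : Jet n := (0, 0, dx, dl, du, dy) with hv
  have hline : ∀ {F : Type _} [NormedAddCommGroup F] [NormedSpace ℝ F] (p v : F),
      HasDerivAt (fun ε : ℝ => p + ε • v) v 0 := fun p v => by
    simpa using ((hasDerivAt_id (0 : ℝ)).smul_const v).const_add p
  have hcomp : ∀ {F : Type _} [NormedAddCommGroup F] [NormedSpace ℝ F] {Φ : F → ℝ} {p : F} (v : F),
      DifferentiableAt ℝ Φ p → HasDerivAt (fun ε : ℝ => Φ (p + ε • v)) (fderiv ℝ Φ p v) 0 := by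
    intro F _ _ Φ p v h
    exact HasFDerivAt.comp_hasDerivAt (f := fun ε : ℝ => p + ε • v) 0
      (by simpa using h.hasFDerivAt) (hline p v)
  have h1 := (hcomp v ((P.contDiffAt_costIntegrand (w := p) h0 hV).differentiableAt (by simp))).add
    (hcomp v ((P.contDiffAt_dynIntegrand (w := p) h0).differentiableAt (by simp)))
  have h2 := (hcomp (dx, dl, du) (P.differentiableAt_H μ t lam u h0 fun j =>
    (hV j).differentiableAt (by simp))).sub (hasDerivAt_dotProduct (hline lam dl) (hline y dy))
  rw [P.fderiv_H_apply μ t lam u h0 fun j => (hV j).differentiableAt (by simp)] at h2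
  have h3 : (fun ε : ℝ => P.costIntegrand μ (p + ε • v)) + (fun ε : ℝ => P.dynIntegrand (p + ε • v))
      = (fun ε : ℝ => P.H μ t ((x, lam, u) + ε • (dx, dl, du)).1
          ((x, lam, u) + ε • (dx, dl, du)).2.1 ((x, lam, u) + ε • (dx, dl, du)).2.2)
        - fun ε : ℝ => (lam + ε • dl) ⬝ᵥ (y + ε • dy) := by
    funext ε
    have hpv : p + ε • v = (P.Fe t, P.zd t, x + ε • dx, lam + ε • dl, u + ε • du, y + ε • dy) := by
      simp [hp, hv]
    simp only [Pi.add_apply, Pi.sub_apply]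
    rw [hpv, costIntegrand_add_dynIntegrand]
    rfl
  rw [h3] at h1
  rw [h1.unique h2, sub_dotProduct, zero_smul, zero_smul, add_zero, add_zero, dotProduct_comm dl y]
  ring

variable {P}

theorem IsAdmissible.quat_ne_zero {μ : ℝ} {c : Candidate n k} (hc : P.IsAdmissible μ c) {t : ℝ}
    (ht : t ∈ Icc c.a c.b) : quat (c.x t) ≠ 0 := fun h => by
  simpa [h] using hc.versor t ht

theorem IsAdmissible.left_mem {μ : ℝ} {c : Candidate n k} (hc : P.IsAdmissible μ c) :
    c.a ∈ Icc c.a c.b := ⟨le_rfl, hc.lt.le⟩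

theorem IsAdmissible.right_mem {μ : ℝ} {c : Candidate n k} (hc : P.IsAdmissible μ c) :
    c.b ∈ Icc c.a c.b := ⟨hc.lt.le, le_rfl⟩

theorem IsAdmissible.continuousOn_integrand {μ : ℝ} {c : Candidate n k} (hc : P.IsAdmissible μ c)
    {dx dl : ℝ → State n} {du : ℝ → Control n} {dy : ℝ → State n} (hdx : Continuous dx)
    (hdl : Continuous dl) (hdu : Continuous du) (hdy : Continuous dy) :
    ContinuousOn (fun t => grad (fun y => P.H μ t y (c.lam t) (c.u t)) (c.x t) ⬝ᵥ dx t
      + (P.f t (c.x t) (c.u t) - deriv c.x t) ⬝ᵥ dl t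
      + P.Hu μ t (c.x t) (c.lam t) (c.u t) ⬝ᵥ du t - c.lam t ⬝ᵥ dy t) (Icc c.a c.b) := by
  have hp : Continuous fun t =>
      ((P.Fe t, P.zd t, c.x t, c.lam t, c.u t, deriv c.x t) : Jet n) := by
    have := P.Fe_cont
    have := P.zd_cont
    have := hc.x_smooth.continuous
    have := hc.lam_smooth.continuous
    have := hc.u_cont
    have := hc.x_smooth.continuous_deriv le_rfl
    fun_prop
  have hv : Continuous fun t => ((0, 0, dx t, dl t, du t, dy t) : Jet n) := by fun_prop
  refine ((continuousOn_fderiv_apply_comp hp hv fun t ht =>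
    P.contDiffAt_costIntegrand (hc.quat_ne_zero ht) (hc.obstacle t ht)).add
    (continuousOn_fderiv_apply_comp hp hv fun t ht =>
      P.contDiffAt_dynIntegrand (hc.quat_ne_zero ht))).congr fun t ht => ?_
  exact (P.fderiv_integrands_apply (hc.quat_ne_zero ht) (hc.obstacle t ht) _ _ _ _).symm

theorem IsAdmissible.continuousOn_grad_H_state {μ : ℝ} {c : Candidate n k}
    (hc : P.IsAdmissible μ c) : ContinuousOn
      (fun t => grad (fun y => P.H μ t y (c.lam t) (c.u t)) (c.x t)) (Icc c.a c.b) :=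
  continuousOn_pi.2 fun i => by
    simpa using hc.continuousOn_integrand (dx := fun _ => Pi.single i 1) (dl := fun _ => 0)
      (du := fun _ => 0) (dy := fun _ => 0) (by fun_prop) (by fun_prop) (by fun_prop) (by fun_prop)

theorem IsAdmissible.continuousOn_f_sub_deriv {μ : ℝ} {c : Candidate n k}
    (hc : P.IsAdmissible μ c) : ContinuousOn
      (fun t => P.f t (c.x t) (c.u t) - deriv c.x t) (Icc c.a c.b) :=
  continuousOn_pi.2 fun i => by
    simpa using hc.continuousOn_integrand (dx := fun _ => 0) (dl := fun _ => Pi.single i 1)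
      (du := fun _ => 0) (dy := fun _ => 0) (by fun_prop) (by fun_prop) (by fun_prop) (by fun_prop)

theorem IsAdmissible.continuousOn_Hu {μ : ℝ} {c : Candidate n k}
    (hc : P.IsAdmissible μ c) : ContinuousOn
      (fun t => P.Hu μ t (c.x t) (c.lam t) (c.u t)) (Icc c.a c.b) :=
  continuousOn_pi.2 fun i => by
    simpa using hc.continuousOn_integrand (dx := fun _ => 0) (dl := fun _ => 0)
      (du := fun _ => Pi.single i 1) (dy := fun _ => 0) (by fun_prop) (by fun_prop) (by fun_prop)
      (by fun_prop)

theorem deriv_G_a (a b : ℝ) (xa xb xi : State n) (nu : FinalIdx n k → ℝ) :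
    deriv (fun a => P.G a xa xi b xb nu) a = P.upsA * (a - P.ae) := by
  have h : HasDerivAt (fun a => P.endCost a b) (P.upsA * (a - P.ae)) a := by
    refine (((((hasDerivAt_id a).sub_const P.ae).pow 2).const_mul (P.upsA / 2)).add_const
      (P.upsB / 2 * (b - P.be) ^ 2)).congr_deriv ?_
    simp
    ring
  exact ((h.add_const _).add_const _).deriv

theorem deriv_G_b (a b : ℝ) (xa xb xi : State n) (nu : FinalIdx n k → ℝ) :
    deriv (fun b => P.G a xa xi b xb nu) b = P.upsB * (b - P.be) := by
  have h : HasDerivAt (fun b => P.endCost a b) (P.upsB * (b - P.be)) b := by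
    refine (((((hasDerivAt_id b).sub_const P.be).pow 2).const_mul (P.upsB / 2)).const_add
      (P.upsA / 2 * (a - P.ae) ^ 2)).congr_deriv ?_
    simp
    ring
  exact ((h.add_const _).add_const _).deriv

theorem IsAdmissible.hasDerivAt_integrals {μ : ℝ} {c : Candidate n k} (hc : P.IsAdmissible μ c)
    (v : Variation n k) :
    HasDerivAt (fun ε : ℝ =>
      (∫ t in (c.a + ε * v.da)..(c.b + ε * v.db),
        P.L μ t (c.x t + ε • v.dx t) (c.u t + ε • v.du t))
      + ∫ t in (c.a + ε * v.da)..(c.b + ε * v.db), (c.lam t + ε • v.dlam t) ⬝ᵥ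
        (P.f t (c.x t + ε • v.dx t) (c.u t + ε • v.du t) - deriv (fun t => c.x t + ε • v.dx t) t))
      ((∫ t in c.a..c.b, (grad (fun y => P.H μ t y (c.lam t) (c.u t)) (c.x t) ⬝ᵥ v.dx t
          + (P.f t (c.x t) (c.u t) - deriv c.x t) ⬝ᵥ v.dlam t
          + P.Hu μ t (c.x t) (c.lam t) (c.u t) ⬝ᵥ v.du t - c.lam t ⬝ᵥ deriv v.dx t))
        + (P.H μ c.b (c.x c.b) (c.lam c.b) (c.u c.b) - c.lam c.b ⬝ᵥ deriv c.x c.b) * v.db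
        - (P.H μ c.a (c.x c.a) (c.lam c.a) (c.u c.a) - c.lam c.a ⬝ᵥ deriv c.x c.a) * v.da) 0 := by
  set p : ℝ → Jet n := fun t => (P.Fe t, P.zd t, c.x t, c.lam t, c.u t, deriv c.x t) with hpdef
  set w : ℝ → Jet n := fun t => (0, 0, v.dx t, v.dlam t, v.du t, deriv v.dx t) with hwdef
  have hp : Continuous p := by
    have := P.Fe_cont
    have := P.zd_cont
    have := hc.x_smooth.continuous
    have := hc.lam_smooth.continuous
    have := hc.u_cont
    have := hc.x_smooth.continuous_deriv le_rfl
    fun_prop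
  have hw : Continuous w := by
    have := v.dx_smooth.continuous
    have := v.dlam_smooth.continuous
    have := v.du_cont
    have := v.dx_smooth.continuous_deriv le_rfl
    fun_prop
  have hC : ∀ t ∈ Icc c.a c.b, ContDiffAt ℝ 1 (P.costIntegrand μ) (p t) := fun t ht =>
    P.contDiffAt_costIntegrand (hc.quat_ne_zero ht) (hc.obstacle t ht)
  have hD : ∀ t ∈ Icc c.a c.b, ContDiffAt ℝ 1 P.dynIntegrand (p t) := fun t ht =>
    P.contDiffAt_dynIntegrand (hc.quat_ne_zero ht)
  have hpw : ∀ (ε t : ℝ), p t + ε • w t = (P.Fe t, P.zd t, c.x t + ε • v.dx t,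
      c.lam t + ε • v.dlam t, c.u t + ε • v.du t, deriv c.x t + ε • deriv v.dx t) := by
    intro ε t
    simp [hpdef, hwdef]
  have hderiv : ∀ ε t : ℝ, deriv (fun t => c.x t + ε • v.dx t) t
      = deriv c.x t + ε • deriv v.dx t := by
    intro ε t
    exact ((hc.x_smooth.differentiable (by simp) t).hasDerivAt.add
      ((v.dx_smooth.differentiable (by simp) t).hasDerivAt.const_smul ε)).deriv
  have h := (hasDerivAt_integral_line hp hw hc.lt hC v.da v.db).add
    (hasDerivAt_integral_line hp hw hc.lt hD v.da v.db)
  refine (h.congr_deriv ?_).congr_of_eventuallyEq (Eventually.of_forall fun ε => ?_)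
  · have hint : (∫ t in c.a..c.b, (grad (fun y => P.H μ t y (c.lam t) (c.u t)) (c.x t) ⬝ᵥ v.dx t
          + (P.f t (c.x t) (c.u t) - deriv c.x t) ⬝ᵥ v.dlam t
          + P.Hu μ t (c.x t) (c.lam t) (c.u t) ⬝ᵥ v.du t - c.lam t ⬝ᵥ deriv v.dx t))
        = (∫ t in c.a..c.b, fderiv ℝ (P.costIntegrand μ) (p t) (w t))
          + ∫ t in c.a..c.b, fderiv ℝ P.dynIntegrand (p t) (w t) := by
      rw [← intervalIntegral.integral_add
        ((continuousOn_fderiv_apply_comp hp hw hC).intervalIntegrable_of_Icc hc.lt.le)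
        ((continuousOn_fderiv_apply_comp hp hw hD).intervalIntegrable_of_Icc hc.lt.le)]
      refine intervalIntegral.integral_congr fun t ht => ?_
      rw [uIcc_of_le hc.lt.le] at ht
      exact (P.fderiv_integrands_apply (hc.quat_ne_zero ht) (hc.obstacle t ht) _ _ _ _).symm
    rw [hint, ← costIntegrand_add_dynIntegrand, ← costIntegrand_add_dynIntegrand]
    ring
  · simp only [Pi.add_apply, hpw, hderiv]
    congr 1
    exact intervalIntegral.integral_congr fun t _ => P.L_eq _ _ _ _

/-- The first variation of `J̃`, before integration by parts. -/
theorem IsAdmissible.hasDerivAt_Jaug {μ : ℝ} {c : Candidate n k} (hc : P.IsAdmissible μ c)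
    (v : Variation n k) :
    HasDerivAt (fun ε : ℝ => P.Jaug μ (c.perturb v ε))
      (P.upsA * (c.a - P.ae) * v.da + P.upsB * (c.b - P.be) * v.db
        + (v.dxi ⬝ᵥ P.sigma (c.x c.a) + c.xi ⬝ᵥ (v.da • deriv c.x c.a + v.dx c.a))
        + (v.dnu ⬝ᵥ P.psi (c.x c.b)
          + c.nu ⬝ᵥ fderiv ℝ P.psi (c.x c.b) (v.db • deriv c.x c.b + v.dx c.b))
        + ((∫ t in c.a..c.b, (grad (fun y => P.H μ t y (c.lam t) (c.u t)) (c.x t) ⬝ᵥ v.dx t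
          + (P.f t (c.x t) (c.u t) - deriv c.x t) ⬝ᵥ v.dlam t
          + P.Hu μ t (c.x t) (c.lam t) (c.u t) ⬝ᵥ v.du t - c.lam t ⬝ᵥ deriv v.dx t))
        + (P.H μ c.b (c.x c.b) (c.lam c.b) (c.u c.b) - c.lam c.b ⬝ᵥ deriv c.x c.b) * v.db
        - (P.H μ c.a (c.x c.a) (c.lam c.a) (c.u c.a) - c.lam c.a ⬝ᵥ deriv c.x c.a) * v.da)) 0 := by
  have hlin : ∀ {F : Type _} [NormedAddCommGroup F] [NormedSpace ℝ F] (p v : F),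
      HasDerivAt (fun ε : ℝ => p + ε • v) v 0 := fun p v => by
    simpa using ((hasDerivAt_id (0 : ℝ)).smul_const v).const_add p
  have hcost : HasDerivAt (fun ε : ℝ => P.endCost (c.a + ε * v.da) (c.b + ε * v.db))
      (P.upsA * (c.a - P.ae) * v.da + P.upsB * (c.b - P.be) * v.db) 0 := by
    have h1 := (((hlin c.a v.da).sub_const P.ae).pow 2).const_mul (P.upsA / 2)
    have h2 := (((hlin c.b v.db).sub_const P.be).pow 2).const_mul (P.upsB / 2)
    refine (h1.add h2).congr_deriv ?_
    simp
    ring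
  have ha := hasDerivAt_add_smul_comp_add_mul hc.x_smooth v.dx_smooth c.a v.da
  have hb := hasDerivAt_add_smul_comp_add_mul hc.x_smooth v.dx_smooth c.b v.db
  have hsig := hasDerivAt_dotProduct (hlin c.xi v.dxi)
    (ha.sub_const (mkState P.thetaA P.dthetaA P.qA P.OmegaA P.zA))
  have hpsi := hasDerivAt_dotProduct (hlin c.nu v.dnu)
    (HasFDerivAt.comp_hasDerivAt (l := P.psi) (l' := fderiv ℝ P.psi (c.x c.b)) 0 (by
      simpa using ((P.contDiffAt_psi contDiffAt_id
        (hc.quat_ne_zero hc.right_mem)).differentiableAt (by simp)).hasFDerivAt) hb)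
  have := ((hcost.add hsig).add hpsi).add (hc.hasDerivAt_integrals v)
  refine (this.congr_deriv ?_).congr_of_eventuallyEq (Eventually.of_forall fun ε => ?_)
  · simp [sigma]
  · simp only [Jaug, J, Candidate.perturb, Pi.add_apply, sigma, Function.comp_apply]
    ring

theorem IsAdmissible.integral_lam_dotProduct_deriv {μ : ℝ} {c : Candidate n k}
    (hc : P.IsAdmissible μ c) {y : ℝ → State n} (hy : ContDiff ℝ 1 y) :
    ∫ t in c.a..c.b, c.lam t ⬝ᵥ deriv y t
      = c.lam c.b ⬝ᵥ y c.b - c.lam c.a ⬝ᵥ y c.a - ∫ t in c.a..c.b, deriv c.lam t ⬝ᵥ y t := by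
  have hlc := hc.lam_smooth.continuous
  have hlc' := hc.lam_smooth.continuous_deriv le_rfl
  have hyc := hy.continuous
  have hyc' := hy.continuous_deriv le_rfl
  have h1 : IntervalIntegrable (fun t => deriv c.lam t ⬝ᵥ y t) volume c.a c.b :=
    (hlc'.dotProduct hyc).intervalIntegrable _ _
  have h2 : IntervalIntegrable (fun t => c.lam t ⬝ᵥ deriv y t) volume c.a c.b :=
    (hlc.dotProduct hyc').intervalIntegrable _ _
  have h := intervalIntegral.integral_eq_sub_of_hasDerivAt (a := c.a) (b := c.b)
    (fun t _ => hasDerivAt_dotProduct (hc.lam_smooth.differentiable (by simp) t).hasDerivAt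
      (hy.differentiable (by simp) t).hasDerivAt) (h1.add h2)
  rw [intervalIntegral.integral_add h1 h2] at h
  linarith

/-- The first variation of `J̃`. -/
def firstVariation (P : Problem n K k) (μ : ℝ) (c : Candidate n k) (v : Variation n k) : ℝ :=
  (P.upsA * (c.a - P.ae) - P.H μ c.a (c.x c.a) (c.lam c.a) (c.u c.a)
      + (c.xi + c.lam c.a) ⬝ᵥ deriv c.x c.a) * v.da
    + (P.upsB * (c.b - P.be) + P.H μ c.b (c.x c.b) (c.lam c.b) (c.u c.b)
      + (grad (fun y => P.G c.a (c.x c.a) c.xi c.b y c.nu) (c.x c.b) - c.lam c.b)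
        ⬝ᵥ deriv c.x c.b) * v.db
    + P.sigma (c.x c.a) ⬝ᵥ v.dxi + P.psi (c.x c.b) ⬝ᵥ v.dnu
    + (c.xi + c.lam c.a) ⬝ᵥ v.dx c.a
    + (grad (fun y => P.G c.a (c.x c.a) c.xi c.b y c.nu) (c.x c.b) - c.lam c.b) ⬝ᵥ v.dx c.b
    + ∫ t in c.a..c.b, ((grad (fun y => P.H μ t y (c.lam t) (c.u t)) (c.x t) + deriv c.lam t)
          ⬝ᵥ v.dx t
        + (P.f t (c.x t) (c.u t) - deriv c.x t) ⬝ᵥ v.dlam t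
        + P.Hu μ t (c.x t) (c.lam t) (c.u t) ⬝ᵥ v.du t)

theorem IsAdmissible.hasDerivAt_Jaug_firstVariation {μ : ℝ} {c : Candidate n k}
    (hc : P.IsAdmissible μ c) (v : Variation n k) :
    HasDerivAt (fun ε : ℝ => P.Jaug μ (c.perturb v ε)) (P.firstVariation μ c v) 0 := by
  refine (hc.hasDerivAt_Jaug v).congr_deriv ?_
  have h1 := (hc.continuousOn_integrand v.dx_smooth.continuous v.dlam_smooth.continuous v.du_cont
    (v.dx_smooth.continuous_deriv le_rfl)).intervalIntegrable_of_Icc (μ := volume) hc.lt.le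
  have h2 : IntervalIntegrable (fun t => c.lam t ⬝ᵥ deriv v.dx t) volume c.a c.b :=
    (hc.lam_smooth.continuous.dotProduct
      (v.dx_smooth.continuous_deriv le_rfl)).intervalIntegrable _ _
  have h3 : IntervalIntegrable (fun t => deriv c.lam t ⬝ᵥ v.dx t) volume c.a c.b :=
    ((hc.lam_smooth.continuous_deriv le_rfl).dotProduct
      v.dx_smooth.continuous).intervalIntegrable _ _
  have key : ∫ t in c.a..c.b, ((grad (fun y => P.H μ t y (c.lam t) (c.u t)) (c.x t)
          + deriv c.lam t) ⬝ᵥ v.dx t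
        + (P.f t (c.x t) (c.u t) - deriv c.x t) ⬝ᵥ v.dlam t
        + P.Hu μ t (c.x t) (c.lam t) (c.u t) ⬝ᵥ v.du t)
      = (∫ t in c.a..c.b, (grad (fun y => P.H μ t y (c.lam t) (c.u t)) (c.x t) ⬝ᵥ v.dx t
          + (P.f t (c.x t) (c.u t) - deriv c.x t) ⬝ᵥ v.dlam t
          + P.Hu μ t (c.x t) (c.lam t) (c.u t) ⬝ᵥ v.du t - c.lam t ⬝ᵥ deriv v.dx t))
        + (∫ t in c.a..c.b, c.lam t ⬝ᵥ deriv v.dx t)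
        + ∫ t in c.a..c.b, deriv c.lam t ⬝ᵥ v.dx t := by
    rw [← intervalIntegral.integral_add h1 h2, ← intervalIntegral.integral_add (h1.add h2) h3]
    refine intervalIntegral.integral_congr fun t _ => ?_
    simp only [add_dotProduct]
    ring
  rw [firstVariation, key, hc.integral_lam_dotProduct_deriv v.dx_smooth]
  rw [← P.grad_G_xb_dotProduct c.a c.b (c.x c.a) (c.x c.b) c.xi c.nu
    (hc.quat_ne_zero hc.right_mem)]
  simp only [dotProduct_add, dotProduct_smul, add_dotProduct, sub_dotProduct, smul_eq_mul,
    dotProduct_comm v.dxi, dotProduct_comm v.dnu]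
  ring

theorem IsAdmissible.isStationary_iff_firstVariation {μ : ℝ} {c : Candidate n k}
    (hc : P.IsAdmissible μ c) (aFree bFree : Prop) :
    P.IsStationary μ aFree bFree c ↔ ∀ v : Variation n k, (¬ aFree → v.da = 0) →
      (¬ bFree → v.db = 0) → P.firstVariation μ c v = 0 := by
  refine forall_congr' fun v => forall_congr' fun _ => forall_congr' fun _ => ⟨fun h => ?_,
    fun h => ?_⟩
  · exact (hc.hasDerivAt_Jaug_firstVariation v).unique h
  · exact h ▸ hc.hasDerivAt_Jaug_firstVariation v

end Problem

end

section

namespace Problem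

variable {n K k : ℕ} {P : Problem n K k}

theorem hasDerivWithinAt_Icc_iff_deriv_eq {F : Type*} [NormedAddCommGroup F] [NormedSpace ℝ F]
    {y : ℝ → F} (hy : ContDiff ℝ 1 y) {a b t : ℝ} (hab : a < b) (ht : t ∈ Icc a b) (y' : F) :
    HasDerivWithinAt y y' (Icc a b) t ↔ deriv y t = y' := by
  have h := (hy.differentiable (by simp) t).hasDerivAt
  refine ⟨fun h' => ?_, fun h' => h' ▸ h.hasDerivWithinAt⟩
  exact (uniqueDiffOn_Icc hab t ht).eq_deriv _ h.hasDerivWithinAt h'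

/-- The variation with all components zero. -/
def zeroVariation (n k : ℕ) : Variation n k where
  da := 0
  db := 0
  dx := 0
  dlam := 0
  du := 0
  dxi := 0
  dnu := 0
  dx_smooth := contDiff_const
  dlam_smooth := contDiff_const
  du_cont := continuous_const

theorem eq_zero_of_forall_dotProduct {ι : Type*} [Fintype ι] {v : ι → ℝ}
    (h : ∀ w, v ⬝ᵥ w = 0) : v = 0 := dotProduct_self_eq_zero.1 (h v)

theorem IsAdmissible.solvesDAE_of_isStationary {μ : ℝ} {aFree bFree : Prop} {c : Candidate n k}
    (hc : P.IsAdmissible μ c) (h : P.IsStationary μ aFree bFree c) :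
    P.SolvesDAE μ aFree bFree c := by
  rw [hc.isStationary_iff_firstVariation] at h
  have hab := hc.lt
  have hsigma : P.sigma (c.x c.a) = 0 := eq_zero_of_forall_dotProduct fun w => by
    simpa [zeroVariation, firstVariation] using
      h { zeroVariation n k with dxi := w } (fun _ => rfl) (fun _ => rfl)
  have hpsi : P.psi (c.x c.b) = 0 := eq_zero_of_forall_dotProduct fun w => by
    simpa [zeroVariation, firstVariation] using
      h { zeroVariation n k with dnu := w } (fun _ => rfl) (fun _ => rfl)
  have hstate : ∀ t ∈ Icc c.a c.b, P.f t (c.x t) (c.u t) - deriv c.x t = 0 :=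
    eq_zero_of_integral_dotProduct_eq_zero hab hc.continuousOn_f_sub_deriv fun φ hφ _ _ => by
      simpa [zeroVariation, firstVariation] using
        h { zeroVariation n k with dlam := φ, dlam_smooth := hφ } (fun _ => rfl) (fun _ => rfl)
  have hcontrol : ∀ t ∈ Icc c.a c.b, P.Hu μ t (c.x t) (c.lam t) (c.u t) = 0 :=
    eq_zero_of_integral_dotProduct_eq_zero hab hc.continuousOn_Hu fun φ hφ _ _ => by
      simpa [zeroVariation, firstVariation] using
        h { zeroVariation n k with du := φ, du_cont := hφ.continuous } (fun _ => rfl) (fun _ => rfl)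
  have hcostate : ∀ t ∈ Icc c.a c.b,
      grad (fun y => P.H μ t y (c.lam t) (c.u t)) (c.x t) + deriv c.lam t = 0 :=
    eq_zero_of_integral_dotProduct_eq_zero hab (hc.continuousOn_grad_H_state.add
      (hc.lam_smooth.continuous_deriv le_rfl).continuousOn) fun φ hφ ha hb => by
        simpa [zeroVariation, firstVariation, ha, hb] using
          h { zeroVariation n k with dx := φ, dx_smooth := hφ } (fun _ => rfl) (fun _ => rfl)
  have hint : ∀ φ : ℝ → State n, (∫ t in c.a..c.b,
      (grad (fun y => P.H μ t y (c.lam t) (c.u t)) (c.x t) + deriv c.lam t) ⬝ᵥ φ t) = 0 := by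
    intro φ
    rw [intervalIntegral.integral_congr (g := fun _ => (0 : ℝ)) fun t ht => ?_]
    · simp
    · rw [uIcc_of_le hab.le] at ht
      simp [hcostate t ht]
  have hba : c.b - c.a ≠ 0 := (sub_pos.2 hab).ne'
  have hxa : c.xi + c.lam c.a = 0 := eq_zero_of_forall_dotProduct fun w => by
    have := h { zeroVariation n k with
      dx := fun t => ((c.b - t) / (c.b - c.a)) • w, dx_smooth := by fun_prop }
      (fun _ => rfl) (fun _ => rfl)
    simpa [zeroVariation, firstVariation, hint, hba, -dotProduct_smul, -add_dotProduct] using this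
  have hxb : grad (fun y => P.G c.a (c.x c.a) c.xi c.b y c.nu) (c.x c.b) - c.lam c.b = 0 :=
    eq_zero_of_forall_dotProduct fun w => by
      have := h { zeroVariation n k with
        dx := fun t => ((t - c.a) / (c.b - c.a)) • w, dx_smooth := by fun_prop }
        (fun _ => rfl) (fun _ => rfl)
      simpa [zeroVariation, firstVariation, hint, hba, -dotProduct_smul, -add_dotProduct] using this
  refine ⟨fun t ht => ?_, fun t ht => ?_, hcontrol, fun hF => ?_, ?_, hsigma, fun hF => ?_, ?_,
    hpsi⟩
  · rw [grad_H_costate, hasDerivWithinAt_Icc_iff_deriv_eq hc.x_smooth hab ht]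
    exact (sub_eq_zero.1 (hstate t ht)).symm
  · rw [hasDerivWithinAt_Icc_iff_deriv_eq hc.lam_smooth hab ht]
    exact (neg_eq_of_add_eq_zero_right (hcostate t ht)).symm
  · have := h { zeroVariation n k with da := 1 } (fun h => absurd hF h) (fun _ => rfl)
    simp only [zeroVariation, firstVariation, hxa, Pi.zero_apply, zero_dotProduct, dotProduct_zero,
      add_zero, mul_zero, mul_one, intervalIntegral.integral_zero] at this
    rw [deriv_G_a]
    linarith
  · rw [grad_G_xa]
    exact (neg_eq_of_add_eq_zero_right hxa).symm
  · have := h { zeroVariation n k with db := 1 } (fun _ => rfl) (fun h => absurd hF h)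
    simp only [zeroVariation, firstVariation, hxb, Pi.zero_apply, zero_dotProduct, dotProduct_zero,
      add_zero, zero_add, mul_zero, mul_one, intervalIntegral.integral_zero] at this
    rw [deriv_G_b]
    linarith
  · exact (sub_eq_zero.1 hxb).symm

theorem IsAdmissible.isStationary_of_solvesDAE {μ : ℝ} {aFree bFree : Prop} {c : Candidate n k}
    (hc : P.IsAdmissible μ c) (h : P.SolvesDAE μ aFree bFree c) :
    P.IsStationary μ aFree bFree c := by
  rw [hc.isStationary_iff_firstVariation]
  intro v hda hdb
  have hint : ∀ t ∈ Icc c.a c.b,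
      (grad (fun y => P.H μ t y (c.lam t) (c.u t)) (c.x t) + deriv c.lam t) ⬝ᵥ v.dx t
        + (P.f t (c.x t) (c.u t) - deriv c.x t) ⬝ᵥ v.dlam t
        + P.Hu μ t (c.x t) (c.lam t) (c.u t) ⬝ᵥ v.du t = 0 := by
    intro t ht
    have h1 := h.state t ht
    have h2 := h.costate t ht
    rw [grad_H_costate, hasDerivWithinAt_Icc_iff_deriv_eq hc.x_smooth hc.lt ht] at h1
    rw [hasDerivWithinAt_Icc_iff_deriv_eq hc.lam_smooth hc.lt ht] at h2
    simp [h1, h2, h.control t ht]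
  have hxa : c.xi + c.lam c.a = 0 := by
    rw [h.costate_a, grad_G_xa, add_neg_cancel]
  have hxb : grad (fun y => P.G c.a (c.x c.a) c.xi c.b y c.nu) (c.x c.b) - c.lam c.b = 0 :=
    sub_eq_zero.2 h.costate_b.symm
  have ha : (P.upsA * (c.a - P.ae) - P.H μ c.a (c.x c.a) (c.lam c.a) (c.u c.a)) * v.da = 0 := by
    by_cases hF : aFree
    · rw [h.time_a hF, deriv_G_a, sub_self, zero_mul]
    · rw [hda hF, mul_zero]
  have hb : (P.upsB * (c.b - P.be) + P.H μ c.b (c.x c.b) (c.lam c.b) (c.u c.b)) * v.db = 0 := by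
    by_cases hF : bFree
    · rw [h.time_b hF, deriv_G_b, add_neg_cancel, zero_mul]
    · rw [hdb hF, mul_zero]
  rw [firstVariation, hxa, hxb, h.init, h.final,
    intervalIntegral.integral_congr (g := fun _ => (0 : ℝ)) fun t ht =>
      hint t (by rwa [uIcc_of_le hc.lt.le] at ht)]
  simp only [zero_dotProduct, add_zero, ha, hb, intervalIntegral.integral_zero]

theorem IsAdmissible.isStationary_iff_solvesDAE {μ : ℝ} {aFree bFree : Prop} {c : Candidate n k}
    (hc : P.IsAdmissible μ c) :
    P.IsStationary μ aFree bFree c ↔ P.SolvesDAE μ aFree bFree c :=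
  ⟨hc.solvesDAE_of_isStationary, hc.isStationary_of_solvesDAE⟩

theorem IsAdmissible.solvesDAE_iff_solvesODE {μ : ℝ} {aFree bFree : Prop} {c : Candidate n k}
    (hc : P.IsAdmissible μ c) (hP : P.IsRegular) :
    P.SolvesDAE μ aFree bFree c ↔
      ((∀ t ∈ Icc c.a c.b, c.u t = P.ctrl (c.x t) (c.lam t)) ∧
        P.SolvesODE μ aFree bFree c) := by
  have hgrad : ∀ t ∈ Icc c.a c.b, grad (fun y => P.Hhat μ t y (c.lam t)) (c.x t)
      = grad (fun y => P.H μ t y (c.lam t) (P.ctrl (c.x t) (c.lam t))) (c.x t) := fun t ht =>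
    grad_Hhat_state hP μ t _ (hc.quat_ne_zero ht) fun j =>
      (hc.obstacle t ht j).differentiableAt (by simp)
  constructor
  · intro h
    have hu : ∀ t ∈ Icc c.a c.b, c.u t = P.ctrl (c.x t) (c.lam t) := fun t ht =>
      (Hu_eq_zero_iff hP _ _ _ _ _).1 (h.control t ht)
    refine ⟨hu, fun t ht => ?_, fun t ht => ?_, fun hF => ?_, h.costate_a, h.init, fun hF => ?_,
      h.costate_b, h.final⟩
    · have := h.state t ht
      rw [grad_H_costate, hu t ht] at this
      rwa [grad_Hhat_costate hP]
    · rw [hgrad t ht, ← hu t ht]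
      exact h.costate t ht
    · rw [← h.time_a hF, hu _ hc.left_mem, Hhat]
    · rw [← h.time_b hF, hu _ hc.right_mem, Hhat]
  · rintro ⟨hu, h⟩
    refine ⟨fun t ht => ?_, fun t ht => ?_, fun t ht => (Hu_eq_zero_iff hP _ _ _ _ _).2 (hu t ht),
      fun hF => ?_, h.costate_a, h.init, fun hF => ?_, h.costate_b, h.final⟩
    · have := h.state t ht
      rw [grad_Hhat_costate hP, fhat] at this
      rwa [grad_H_costate, hu t ht]
    · rw [hu t ht, ← hgrad t ht]
      exact h.costate t ht
    · rw [← h.time_a hF, hu _ hc.left_mem, Hhat]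
    · rw [← h.time_b hF, hu _ hc.right_mem, Hhat]

end Problem

end

end RollingBall

end

open RollingBall in
theorem mainTheorem1 {n K k : ℕ} (P : Problem n K k) :
    -- the matrix `∑ m_i ŝ_i² - 𝕀` is invertible
    (∀ x : State n, IsUnit (P.massMatrix x)) ∧
    -- first and second derivatives of the Hamiltonian in the control
    (∀ (μ t : ℝ) (x lam : State n) (u : Control n),
      ContDiff ℝ ∞ (fun w => P.H μ t x lam w) ∧
      (∀ i : Fin n, P.Hu μ t x lam u i
        = P.γ i * u i + dtheta lam i
          + Omega lam ⬝ᵥ ((P.massMatrix x)⁻¹ *ᵥ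
              (P.m i.succ • (P.s x i.succ ⨯₃ P.dzetaAt x i.succ)))) ∧
      P.Huu μ t x lam u = Matrix.diagonal P.γ ∧
      ((P.Huu μ t x lam u).PosDef ↔ ∀ i, 0 < P.γ i)) ∧
    -- regularity
    (P.IsRegular ↔ ∀ i, 0 < P.γ i) ∧
    -- the explicit control law in the regular case
    (P.IsRegular → ∀ (μ t : ℝ) (x lam : State n) (u : Control n),
      (∀ i : Fin n, P.Hu μ t x lam u i = 0 ↔
        u i = -(P.γ i)⁻¹ * (dtheta lam i
          + Omega lam ⬝ᵥ ((P.massMatrix x)⁻¹ *ᵥ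
              (P.m i.succ • (P.s x i.succ ⨯₃ P.dzetaAt x i.succ))))) ∧
      (P.Hu μ t x lam u = 0 ↔ u = P.ctrl x lam)) ∧
    -- the derivatives of the Hamiltonian in the costate and of `G` in the multipliers
    (∀ (μ t : ℝ) (x lam : State n) (u : Control n),
      Differentiable ℝ (fun l => P.H μ t x l u) ∧
      grad (fun l => P.H μ t x l u) lam = P.f t x u) ∧
    (∀ (a b : ℝ) (xa xb xi : State n) (nu : FinalIdx n k → ℝ),
      grad (fun y => P.G a xa y b xb nu) xi = P.sigma xa ∧
      grad (fun y => P.G a xa xi b xb y) nu = P.psi xb) ∧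
    -- the derivatives of the regular Hamiltonian
    (P.IsRegular → ∀ (μ t : ℝ) (x lam : State n),
      Differentiable ℝ (fun l => P.Hhat μ t x l) ∧
      grad (fun l => P.Hhat μ t x l) lam = P.fhat t x lam ∧
      (‖quat x‖ = 1 → (∀ j, DifferentiableAt ℝ (fun z => P.V j z μ) (zpos x)) →
        DifferentiableAt ℝ (fun y => P.Hhat μ t y lam) x ∧
        DifferentiableAt ℝ (fun y => P.H μ t y lam (P.ctrl x lam)) x ∧
        grad (fun y => P.Hhat μ t y lam) x
          = grad (fun y => P.H μ t y lam (P.ctrl x lam)) x)) ∧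
    -- extremals: `dJ̃ = 0`, the boundary value problem for `H`, and the one for `Ĥ`
    (∀ (μ : ℝ) (aFree bFree : Prop) (c : Candidate n k), P.IsAdmissible μ c →
      (P.IsStationary μ aFree bFree c ↔ P.SolvesDAE μ aFree bFree c) ∧
      (P.IsRegular →
        (P.IsStationary μ aFree bFree c ↔
          ((∀ t ∈ Set.Icc c.a c.b, c.u t = P.ctrl (c.x t) (c.lam t)) ∧
            P.SolvesODE μ aFree bFree c)))) := by
  refine ⟨P.isUnit_massMatrix, fun μ t x lam u => ⟨P.contDiff_H_control μ t x lam, fun i => ?_,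
    P.Huu_eq μ t x lam u, P.posDef_Huu_iff μ t x lam u⟩, P.isRegular_iff,
    fun hP μ t x lam u => ⟨Problem.Hu_apply_eq_zero_iff hP μ t x lam u,
      Problem.Hu_eq_zero_iff hP μ t x lam u⟩,
    fun μ t x lam u => ⟨fun l => (P.hasFDerivAt_H_costate μ t x l u).differentiableAt,
      P.grad_H_costate μ t x lam u⟩,
    fun a b xa xb xi nu => ⟨P.grad_G_xi a b xa xb xi nu, P.grad_G_nu a b xa xb xi nu⟩,
    fun hP μ t x lam => ⟨fun l => (Problem.hasFDerivAt_Hhat_costate hP μ t x l).differentiableAt,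
      Problem.grad_Hhat_costate hP μ t x lam, fun hq hV => ?_⟩,
    fun μ aFree bFree c hc => ⟨hc.isStationary_iff_solvesDAE, fun hP =>
      hc.isStationary_iff_solvesDAE.trans (hc.solvesDAE_iff_solvesODE hP)⟩⟩
  · simp only [P.Hu_eq, Problem.controlCoeff, add_assoc]
  · have h0 : quat x ≠ 0 := fun h => by simp [h] at hq
    exact ⟨(Problem.hasFDerivAt_Hhat_state hP μ t lam h0 hV).differentiableAt,
      Problem.differentiableAt_H_state μ t lam _ h0 hV,
      Problem.grad_Hhat_state hP μ t lam h0 hV⟩
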